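/- **Setting.** Let $(\mathcal C,\mathcal M)$ be an adhesive HLR category: $\mathcal M$ is a class of monomorphisms that contains all isomorphisms and is closed under composition and decomposition ($g\circ f, g\in\mathcal M\Rightarrow f\in\mathcal M$), pushouts and pullbacks along $\mathcal M$-morphisms exist and preserve $\mathcal M$, and pushouts along $\mathcal M$-morphisms are van Kampen squares. Assume that $\mathcal C$ has all pullbacks, binary coproducts, an initial object $\bot$ with all $!_X\colon\bot\to X$ in $\mathcal M$, initial pushouts over $\mathcal M$-morphisms, a class $\mathcal E'$ of cospans such that each cospan factors, uniquely up to isomorphism, as a cospan in $\mathcal E'$ followed by an $\mathcal M$-morphism, initial transformations (see below), and a pushout of every span that occurs in some commutative square. *Conditions.* Nested conditions over an object $P$ are built from $\mathrm{true}$ by Boolean operations and by $\exists(p\colon P\to P',d)$, $\forall(p\colon P\to P',d)$ with $d$ a condition over $P'$; $q\colon P\to G$ satisfies $\exists(p,d)$ if $q=q'\circ p$ for some $q'\colon P'\to G$ in $\mathcal M$ with $q'\models d$, and $\forall(p,d)=\neg\exists(p,\neg d)$. The application conditions of rules are in normal form: all morphisms in them, except possibly those starting at the root object, are in $\mathcal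 M$, none is an isomorphism, and negation is applied to $\mathrm{true}$ only. The quantified morphisms of a condition form a tree. $\mathrm{Shift}$ and $\mathrm{Left}$ denote the usual shift of a condition along a morphism and translation along a span. *Transformations.* A rule $\rho=(L\xleftarrow{l}K\xrightarrow{r}R,\mathit{ac})$ consists of $l,r\in\mathcal M$ and a condition $\mathit{ac}$ over $L$. An ac-disregarding transformation $t\colon G\Rightarrow_{\rho,m}H$ is a double pushout with match $m\colon L\to G$ and span $G\xleftarrow{g}D\xrightarrow{h}H$; it is a transformation if $m\models\mathit{ac}$. A pair $(t_1,t_2)$ via $\rho_1,\rho_2$ with common $G$ is parallel independent ac-disregarding if there are $d_1\colon L_2\to D_1$, $d_2\colon L_1\to D_2$ with $g_1d_1=m_2$, $g_2d_2=m_1$; a pair of transformations is parallel independent if moreover $h_1d_1\models\mathit{ac}_2$ and $h_2d_2\models\mathit{ac}_1$, and conflicting otherwise. A morphism $f\colon G\to G'$ is an extension morphism (gives an extension diagram) from $t$ to $t'$ if $fm=m'$ and $t'$ arises by applying the span $G\leftarrow D\to H$ of $t$ as a rule at $f$, compatibly with the comatches. A pair $I$ is initial for a pair $T$ if there is a common extension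 morphism $f\colon I\to T$ that factors uniquely through every common extension morphism $S\to T$, with the factor an extension morphism $I\to S$. The category has initial transformations if each pair of ac-disregarding transformations via plain rules has an initial pair. *Initial conflicts.* A pair $K$ of ac-disregarding transformations on $G$ carries the conditions $\mathit{ac}_K=\mathrm{Shift}(m_1,\mathit{ac}_1)\wedge\mathrm{Shift}(m_2,\mathit{ac}_2)$ and $\mathit{ac}^*_K=\neg(a_1\wedge a_2)$, where $a_1=\mathrm{Left}(G\leftarrow D_1\to H_1,\mathrm{Shift}(h_1d_1,\mathit{ac}_2))$ if $d_1$ exists and $a_1=\mathrm{false}$ otherwise, and $a_2$ is defined symmetrically. $K$ is an initial conflict if it is initial for itself and extends to some conflicting pair of transformations. $K$ is embedded in a pair of transformations $T$ if some common extension morphism $K\to T$ satisfies $\mathit{ac}_K\wedge\mathit{ac}^*_K$. *Overlaps.* An overlap of $\rho_1,\rho_2$ is a span $P_1\xleftarrow{b_1}A\xrightarrow{b_2}P_2$ with morphisms $p_1\colon L_1\to P_1$, $p_2\colon L_2\to P_2$. It is embedded in a pair $(t_1,t_2)$ via $f_1\colon P_1\to G$, $f_2\colon P_2\to G$ if $f_1p_1=m_1$,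 $f_2p_2=m_2$ and $A$ is the pullback of $f_1,f_2$. It is ac-conflicting if it embeds in some pair of ac-disregarding transformations that is parallel independent ac-disregarding. A composition of overlaps $o,o'$ is an overlap $o^*$ with $(x\colon P_1\to P_1^*,x'\colon P_1'\to P_1^*),(y\colon P_2\to P_2^*,y'\colon P_2'\to P_2^*),(k_1\colon P_1^*\to Q,k_2\colon P_2^*\to Q)$ in $\mathcal E'$, $k_1,k_2\in\mathcal M$, $p_1^*=xp_1=x'p_1'$, $p_2^*=yp_2=y'p_2'$, such that $A^*$, $A$, $A'$ are the pullbacks of $(k_1,k_2)$, $(k_1x,k_2y)$ and $(k_1x',k_2y')$ respectively. *Disabling essences.* For $l\colon K\to L$ in $\mathcal M$ and $e\colon L\to X$, $e'\colon P\to X$, let $L\leftarrow A\to P$ be the pullback of $(e,e')$, $k\colon A'\to A$ the pullback of $l$ along $A\to L$, and $c\colon C\to A$ the lower morphism of the initial pushout over $k$; the proto-essence is trivial if $C$ is initial. Let $L_2=P_0\to P_1\to\dots\to P_n$ be a path from the root to a leaf in the tree of $\mathit{ac}_2$, with $(e\colon L_1\to X,e_n\colon P_n\to X)\in\mathcal E'$,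 $e_n\in\mathcal M$, or let $n=0$ and $(e,e_0)\in\mathcal E'$. Let $i$ be the first level at which the proto-essence for $l_1$, $e$ and $P_i\to P_n\to X$ is non-trivial. If it exists and $i=0$ or $P_i$ is existentially bound, then the overlap $L_1\leftarrow A\to P_i$ (with $\mathrm{id}_{L_1}$ and the path $L_2\to P_i$) is a disabling essence by deletion of $\rho_1$ in $\rho_2$, provided it embeds, via a cospan in $\mathcal E'$, in some pair of ac-disregarding transformations. For insertion, use instead $r_1$, a cospan $(e\colon R_1\to X,e_n\colon P_n\to X)\in\mathcal E'$ with $e_n\in\mathcal M$, $n\ge1$, levels $i\ge 1$ and universally bound $P_i$, and replace the span by $L_1\leftarrow K_1\leftarrow A'\to P'$, where $A'\to P'\to P_i$ is a pushout complement of $A'\to A\to P_i$ and $L_2\to P_i$ factors through $P'$; the same proviso applies. *Conflict essences.* The set of conflict essences of $\rho_1,\rho_2$ is the smallest set of overlaps that contains (viewed as overlaps of $\rho_1,\rho_2$) each disabling essence of $\rho_1$ in $\rho_2$ or of $\rho_2$ in $\rho_1$ that is ac-conflicting or is a span between $L_1$ and $L_2$ themselves, and that contains all compositions of two of its members that are both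 ac-conflicting or both not ac-conflicting. A symbolic conflict essence is a conflict essence $o$ with the condition $\mathrm{true}$ if $o$ is not ac-conflicting, and otherwise with the cospan condition $\exists(P_1\xrightarrow{d_1}D\xleftarrow{d_2}P_2,\ \mathrm{Shift}(m^*,\mathit{ac}_{L_1+L_2}\wedge\mathit{ac}^*_{L_1+L_2}))$, where $D$ is the pushout of $b_1,b_2$, $m^*=[d_1p_1,d_2p_2]\colon L_1+L_2\to D$, and the two conditions are those of the pair $R_1+L_2\Leftarrow L_1+L_2\Rightarrow L_1+R_2$ whose matches are the coproduct injections. Morphisms $(f_1,f_2)$ into $G$ satisfy $\exists(d_1,d_2,d)$ if there is $q\colon D\to G$ with $q\models d$, $f_1=qd_1$, $f_2=qd_2$. A symbolic conflict essence is embedded in a pair of transformations if some embedding $(f_1,f_2)$ of its overlap satisfies its condition. **Theorem (Relation of symbolic conflict essences and initial conflicts).** Let $\rho_1,\rho_2$ be rules with application conditions. 1. For each symbolic conflict essence $s$ of $\rho_1,\rho_2$ that is embedded in at least one pair of transformations, there is an initial conflict $K$ that is embedded in every pair of transformations in which $s$ is embedded. It is unique up to isomorphism: every initial conflict that has an extension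 diagram to each pair of transformations in which $s$ is embedded is isomorphic to $K$. 2. Whenever an initial conflict is embedded in a pair of transformations, at least one symbolic conflict essence of $\rho_1,\rho_2$ is embedded in that pair. -/

import Mathlib

open CategoryTheory CategoryTheory.Limits

universe v u

namespace ConflictEssence

/-! ### The ambient category -/

/-- A class of cospans (pairs of morphisms with the same codomain). -/
abbrev CospanClass (C : Type u) [Category.{v} C] : Type (max u v) :=
  ∀ ⦃X Y Z : C⦄, (X ⟶ Z) → (Y ⟶ Z) → Prop

/-- `(C, M)` is an adhesive HLR category: `M` is a class of monomorphisms that contains the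
isomorphisms and is closed under composition and decomposition, pushouts and pullbacks along
`M`-morphisms exist and preserve membership in `M`, and pushouts along `M`-morphisms are van Kampen
squares. -/
structure IsAdhesiveHLR {C : Type u} [Category.{v} C] (M : MorphismProperty C) : Prop where
  mono : ∀ ⦃X Y : C⦄ (f : X ⟶ Y), M f → Mono f
  iso_mem : ∀ ⦃X Y : C⦄ (f : X ⟶ Y), IsIso f → M f
  comp_mem : ∀ ⦃X Y Z : C⦄ (f : X ⟶ Y) (g : Y ⟶ Z), M f → M g → M (f ≫ g)
  of_comp : ∀ ⦃X Y Z : C⦄ (f : X ⟶ Y) (g : Y ⟶ Z), M (f ≫ g) → M g → M f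
  hasPushout : ∀ ⦃X Y Z : C⦄ (f : X ⟶ Y) (g : X ⟶ Z), M f → HasPushout f g
  hasPullback : ∀ ⦃X Y Z : C⦄ (f : X ⟶ Z) (g : Y ⟶ Z), M f → HasPullback f g
  pushout_mem : M.IsStableUnderCobaseChange
  pullback_mem : M.IsStableUnderBaseChange
  vanKampen : ∀ ⦃W X Y Z : C⦄ (f : W ⟶ X) (g : W ⟶ Y) (h : X ⟶ Z) (i : Y ⟶ Z)
    (sq : IsPushout f g h i), M f → sq.IsVanKampen

/-- Every cospan factors, uniquely up to isomorphism, as a cospan in `E` followed by a morphism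
in `M`. -/
structure HasPairFactorization {C : Type u} [Category.{v} C] (E : CospanClass C)
    (M : MorphismProperty C) : Prop where
  exists_factor : ∀ ⦃X Y Z : C⦄ (f : X ⟶ Z) (g : Y ⟶ Z),
    ∃ (W : C) (e : X ⟶ W) (e' : Y ⟶ W) (m : W ⟶ Z),
      E e e' ∧ M m ∧ e ≫ m = f ∧ e' ≫ m = g
  unique_factor : ∀ ⦃X Y Z W W' : C⦄ (e : X ⟶ W) (e' : Y ⟶ W) (m : W ⟶ Z)
    (d : X ⟶ W') (d' : Y ⟶ W') (n : W' ⟶ Z), E e e' → M m → E d d' → M n →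
      e ≫ m = d ≫ n → e' ≫ m = d' ≫ n →
      ∃ φ : W ≅ W', e ≫ φ.hom = d ∧ e' ≫ φ.hom = d' ∧ φ.hom ≫ n = m

/-- The square with top `b : B ⟶ A`, left `k' : B ⟶ Q`, right `k : A ⟶ A'` and bottom
`c : Q ⟶ A'` is an initial pushout over `k`. -/
structure IsInitialPushout {C : Type u} [Category.{v} C] (M : MorphismProperty C)
    {B A Q A' : C} (b : B ⟶ A) (k' : B ⟶ Q) (k : A ⟶ A') (c : Q ⟶ A') : Prop where
  boundary_mem : M b
  isPushout : IsPushout b k' k c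
  initial : ∀ ⦃D F : C⦄ (d : D ⟶ A) (x : D ⟶ F) (e : F ⟶ A'), M d → IsPushout d x k e →
    ∃! p : (B ⟶ D) × (Q ⟶ F), M p.1 ∧ M p.2 ∧ p.1 ≫ d = b ∧ p.2 ≫ e = c ∧
      IsPushout p.1 k' x p.2

/-! ### Nested conditions -/

/-- Nested conditions over an object, with conjunctions and disjunctions over arbitrary index
types (true is the empty conjunction, but it is also provided separately). -/
inductive Cond {C : Type u} [Category.{v} C] : C → Type (max u v + 1)
  | tru {P : C} : Cond P
  | neg {P : C} (c : Cond P) : Cond P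
  | conj {P : C} {ι : Type (max u v)} (c : ι → Cond P) : Cond P
  | disj {P : C} {ι : Type (max u v)} (c : ι → Cond P) : Cond P
  | ex {P P' : C} (p : P ⟶ P') (d : Cond P') : Cond P
  | all {P P' : C} (p : P ⟶ P') (d : Cond P') : Cond P

/-- The condition false. -/
def Cond.fls {C : Type u} [Category.{v} C] {P : C} : Cond P := Cond.neg Cond.tru

/-- Binary conjunction. -/
def Cond.and {C : Type u} [Category.{v} C] {P : C} (c d : Cond P) : Cond P :=
  Cond.conj (ι := ULift.{max u v} Bool) fun i => if i.down then c else d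

/-- Satisfaction `q ⊨ c`. The universal quantifier is `¬ ∃ ¬`. -/
def Cond.Sat {C : Type u} [Category.{v} C] (M : MorphismProperty C) :
    {P : C} → Cond P → {G : C} → (P ⟶ G) → Prop
  | _, .tru, _, _ => True
  | _, .neg c, _, q => ¬ c.Sat M q
  | _, .conj c, _, q => ∀ i, (c i).Sat M q
  | _, .disj c, _, q => ∃ i, (c i).Sat M q
  | _, .ex (P' := P') p d, G, q => ∃ q₁ : P' ⟶ G, M q₁ ∧ p ≫ q₁ = q ∧ d.Sat M q₁
  | _, .all (P' := P') p d, G, q => ¬ ∃ q₁ : P' ⟶ G, M q₁ ∧ p ≫ q₁ = q ∧ ¬ d.Sat M q₁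

/-- All morphisms in the condition are in `M`, none is an isomorphism, and negation is applied
to `true` only. -/
def Cond.IsStrictNormal {C : Type u} [Category.{v} C] (M : MorphismProperty C) :
    {P : C} → Cond P → Prop
  | _, .tru => True
  | _, .neg c => c = .tru
  | _, .conj c => ∀ i, (c i).IsStrictNormal M
  | _, .disj c => ∀ i, (c i).IsStrictNormal M
  | _, .ex p d => M p ∧ ¬ IsIso p ∧ d.IsStrictNormal M
  | _, .all p d => M p ∧ ¬ IsIso p ∧ d.IsStrictNormal M

/-- As `Cond.IsStrictNormal`, except that the morphisms that start at the object over which the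
condition is defined need not be in `M`. -/
def Cond.IsNormal {C : Type u} [Category.{v} C] (M : MorphismProperty C) :
    {P : C} → Cond P → Prop
  | _, .tru => True
  | _, .neg c => c = .tru
  | _, .conj c => ∀ i, (c i).IsNormal M
  | _, .disj c => ∀ i, (c i).IsNormal M
  | _, .ex p d => ¬ IsIso p ∧ d.IsStrictNormal M
  | _, .all p d => ¬ IsIso p ∧ d.IsStrictNormal M

/-- Commutative squares `a ≫ b' = b ≫ a'` whose cospan `(a', b')` lies in `E`, with `b'` in `M`. -/
structure ShiftIndex {C : Type u} [Category.{v} C] (M : MorphismProperty C) (E : CospanClass C)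
    {P P' P₁ : C} (b : P ⟶ P') (a : P ⟶ P₁) where
  X : C
  a' : P' ⟶ X
  b' : P₁ ⟶ X
  mem : E a' b'
  b'_mem : M b'
  w : a ≫ b' = b ≫ a'

/-- The shift of a condition along a morphism: `q ⊨ Shift(b, c)` iff `b ≫ q ⊨ c`. -/
def Cond.shift {C : Type u} [Category.{v} C] (M : MorphismProperty C) (E : CospanClass C) :
    {P : C} → Cond P → {P' : C} → (P ⟶ P') → Cond P'
  | _, .tru, _, _ => .tru
  | _, .neg c, _, b => .neg (c.shift M E b)
  | _, .conj c, _, b => .conj fun i => (c i).shift M E b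
  | _, .disj c, _, b => .disj fun i => (c i).shift M E b
  | _, .ex a d, _, b => .disj fun i : ShiftIndex M E b a => .ex i.a' (d.shift M E i.b')
  | _, .all a d, _, b => .conj fun i : ShiftIndex M E b a => .all i.a' (d.shift M E i.b')

/-- For a span `G ← D → H` and `a : H ⟶ X`: a pushout complement `D → Z → X` of `D → H → X`
together with the pushout `Y` of `G ← D → Z`. -/
structure LeftStep {C : Type u} [Category.{v} C] {G D H X : C} (g : D ⟶ G) (h : D ⟶ H)
    (a : H ⟶ X) where
  Z : C
  Y : C
  z : D ⟶ Z
  h' : Z ⟶ X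
  y : G ⟶ Y
  g' : Z ⟶ Y
  complement : IsPushout h z a h'
  isPushout : IsPushout g z y g'

open Classical in
/-- The left translation of a condition over `H` along a span `G ← D → H`. -/
noncomputable def Cond.left {C : Type u} [Category.{v} C] :
    {H : C} → Cond H → {G D : C} → (D ⟶ G) → (D ⟶ H) → Cond G
  | _, .tru, _, _, _, _ => .tru
  | _, .neg c, _, _, g, h => .neg (c.left g h)
  | _, .conj c, _, _, g, h => .conj fun i => (c i).left g h
  | _, .disj c, _, _, g, h => .disj fun i => (c i).left g h
  | _, .ex a d, _, _, g, h =>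
      if s : Nonempty (LeftStep g h a) then .ex s.some.y (d.left s.some.g' s.some.h') else .fls
  | _, .all a d, _, _, g, h =>
      if s : Nonempty (LeftStep g h a) then .all s.some.y (d.left s.some.g' s.some.h') else .tru

/-! ### Rules and transformations -/

/-- A plain rule: a span `L ← K → R` of `M`-morphisms. -/
structure PlainRule {C : Type u} [Category.{v} C] (M : MorphismProperty C) where
  L : C
  K : C
  R : C
  l : K ⟶ L
  r : K ⟶ R
  l_mem : M l
  r_mem : M r

/-- A rule with an application condition (in the normal form assumed of all such conditions). -/
structure Rule {C : Type u} [Category.{v} C] (M : MorphismProperty C) extends PlainRule M where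
  ac : Cond L
  ac_normal : ac.IsNormal M

/-- An ac-disregarding transformation `G ⟹ H` via `ρ`: a double pushout. -/
structure Transformation {C : Type u} [Category.{v} C] {M : MorphismProperty C}
    (ρ : PlainRule M) (G : C) where
  D : C
  H : C
  m : ρ.L ⟶ G
  k : ρ.K ⟶ D
  n : ρ.R ⟶ H
  g : D ⟶ G
  h : D ⟶ H
  isPushout_left : IsPushout ρ.l k m g
  isPushout_right : IsPushout ρ.r k n h

/-- A pair of ac-disregarding transformations with the same input object. -/
structure TransPair {C : Type u} [Category.{v} C] {M : MorphismProperty C}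
    (ρ₁ ρ₂ : PlainRule M) where
  G : C
  t₁ : Transformation ρ₁ G
  t₂ : Transformation ρ₂ G

/-- Both matches satisfy the application conditions: the pair is a pair of transformations in
the full sense. -/
def TransPair.IsValid {C : Type u} [Category.{v} C] {M : MorphismProperty C} {ρ₁ ρ₂ : Rule M}
    (T : TransPair ρ₁.toPlainRule ρ₂.toPlainRule) : Prop :=
  ρ₁.ac.Sat M T.t₁.m ∧ ρ₂.ac.Sat M T.t₂.m

def TransPair.ParallelIndependentAcDisregarding {C : Type u} [Category.{v} C]
    {M : MorphismProperty C} {ρ₁ ρ₂ : PlainRule M} (T : TransPair ρ₁ ρ₂) : Prop :=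
  (∃ d₁ : ρ₂.L ⟶ T.t₁.D, d₁ ≫ T.t₁.g = T.t₂.m) ∧ (∃ d₂ : ρ₁.L ⟶ T.t₂.D, d₂ ≫ T.t₂.g = T.t₁.m)

def TransPair.ParallelIndependent {C : Type u} [Category.{v} C] {M : MorphismProperty C}
    {ρ₁ ρ₂ : Rule M} (T : TransPair ρ₁.toPlainRule ρ₂.toPlainRule) : Prop :=
  (∃ d₁ : ρ₂.L ⟶ T.t₁.D, d₁ ≫ T.t₁.g = T.t₂.m ∧ ρ₂.ac.Sat M (d₁ ≫ T.t₁.h)) ∧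
  (∃ d₂ : ρ₁.L ⟶ T.t₂.D, d₂ ≫ T.t₂.g = T.t₁.m ∧ ρ₁.ac.Sat M (d₂ ≫ T.t₂.h))

/-- `f` is an extension morphism from `t` to `t'`: `t'` is obtained by applying the span of `t`,
considered as a rule, at the match `f`. -/
def Transformation.IsExtension {C : Type u} [Category.{v} C] {M : MorphismProperty C}
    {ρ : PlainRule M} {G G' : C} (t : Transformation ρ G) (t' : Transformation ρ G')
    (f : G ⟶ G') : Prop :=
  t.m ≫ f = t'.m ∧ ∃ (d : t.D ⟶ t'.D) (e : t.H ⟶ t'.H),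
    t.k ≫ d = t'.k ∧ t.n ≫ e = t'.n ∧ IsPushout t.g d f t'.g ∧ IsPushout t.h d e t'.h

/-- `f` is a common extension morphism (an extension diagram) from the pair `T` to `T'`. -/
def TransPair.IsExtension {C : Type u} [Category.{v} C] {M : MorphismProperty C}
    {ρ₁ ρ₂ : PlainRule M} (T T' : TransPair ρ₁ ρ₂) (f : T.G ⟶ T'.G) : Prop :=
  T.t₁.IsExtension T'.t₁ f ∧ T.t₂.IsExtension T'.t₂ f

/-- Isomorphism of transformation pairs. -/
def TransPair.IsIsomorphic {C : Type u} [Category.{v} C] {M : MorphismProperty C}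
    {ρ₁ ρ₂ : PlainRule M} (T T' : TransPair ρ₁ ρ₂) : Prop :=
  ∃ φ : T.G ≅ T'.G, T.IsExtension T' φ.hom ∧ T'.IsExtension T φ.inv

/-- `I` is an initial transformation pair for `T`. -/
def TransPair.IsInitialFor {C : Type u} [Category.{v} C] {M : MorphismProperty C}
    {ρ₁ ρ₂ : PlainRule M} (I T : TransPair ρ₁ ρ₂) : Prop :=
  ∃ f : I.G ⟶ T.G, I.IsExtension T f ∧
    ∀ (S : TransPair ρ₁ ρ₂) (x : S.G ⟶ T.G), S.IsExtension T x →
      ∃! y : I.G ⟶ S.G, I.IsExtension S y ∧ y ≫ x = f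

/-- The standing assumptions on the ambient category (besides all pullbacks and binary
coproducts). The last one says that every span that occurs in some commutative square has a
pushout. -/
structure Setting {C : Type u} [Category.{v} C] [HasInitial C] (M : MorphismProperty C)
    (E : CospanClass C) : Prop where
  adhesive : IsAdhesiveHLR M
  initial_mem : ∀ X : C, M (initial.to X)
  initialPushouts : ∀ ⦃A A' : C⦄ (k : A ⟶ A'), M k →
    ∃ (B Q : C) (b : B ⟶ A) (k' : B ⟶ Q) (c : Q ⟶ A'), IsInitialPushout M b k' k c
  factorization : HasPairFactorization E M
  initialTransformations : ∀ (ρ₁ ρ₂ : PlainRule M) (T : TransPair ρ₁ ρ₂),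
    ∃ I : TransPair ρ₁ ρ₂, I.IsInitialFor T
  boundedPushouts : ∀ ⦃X Y Z W : C⦄ (f : X ⟶ Y) (g : X ⟶ Z) (h : Y ⟶ W) (i : Z ⟶ W),
    f ≫ h = g ≫ i → HasPushout f g

/-! ### Symbolic transformation pairs and initial conflicts

The two conditions of a symbolic transformation pair are determined by the underlying pair of
ac-disregarding transformations, so such a pair is represented by its underlying pair. -/

/-- The condition `ac_G`. -/
def TransPair.acCond {C : Type u} [Category.{v} C] {M : MorphismProperty C} (E : CospanClass C)
    {ρ₁ ρ₂ : Rule M} (T : TransPair ρ₁.toPlainRule ρ₂.toPlainRule) : Cond T.G :=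
  (ρ₁.ac.shift M E T.t₁.m).and (ρ₂.ac.shift M E T.t₂.m)

open Classical in
/-- For a transformation `t` with span `G ← D → H` and a morphism `m : L ⟶ G`: the condition
`Left(G ← D → H, Shift(d ≫ h, ac))` if `m` factors as `d ≫ g`, and false otherwise. -/
noncomputable def Transformation.preservationCond {C : Type u} [Category.{v} C]
    {M : MorphismProperty C} (E : CospanClass C) {ρ : PlainRule M} {G L : C}
    (t : Transformation ρ G) (m : L ⟶ G) (ac : Cond L) : Cond G :=
  if hd : ∃ d : L ⟶ t.D, d ≫ t.g = m then (ac.shift M E (hd.choose ≫ t.h)).left t.g t.h else .fls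

/-- The condition `ac*_G`. -/
noncomputable def TransPair.conflictCond {C : Type u} [Category.{v} C] {M : MorphismProperty C}
    (E : CospanClass C) {ρ₁ ρ₂ : Rule M} (T : TransPair ρ₁.toPlainRule ρ₂.toPlainRule) :
    Cond T.G :=
  .neg ((T.t₁.preservationCond E T.t₂.m ρ₂.ac).and (T.t₂.preservationCond E T.t₁.m ρ₁.ac))

/-- The pair `K` (with its two conditions) is an initial conflict: it is an initial
transformation pair for itself and extends to some conflicting pair of transformations. -/
def TransPair.IsInitialConflict {C : Type u} [Category.{v} C] {M : MorphismProperty C}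
    {ρ₁ ρ₂ : Rule M} (K : TransPair ρ₁.toPlainRule ρ₂.toPlainRule) : Prop :=
  K.IsInitialFor K ∧
    ∃ T : TransPair ρ₁.toPlainRule ρ₂.toPlainRule, T.IsValid ∧ ¬ T.ParallelIndependent ∧
      ∃ f : K.G ⟶ T.G, K.IsExtension T f

/-- The symbolic transformation pair `K` is embedded in `T`: there is an extension diagram whose
extension morphism satisfies both conditions of `K`. -/
def TransPair.EmbedsIn {C : Type u} [Category.{v} C] {M : MorphismProperty C} (E : CospanClass C)
    {ρ₁ ρ₂ : Rule M} (K T : TransPair ρ₁.toPlainRule ρ₂.toPlainRule) : Prop :=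
  ∃ f : K.G ⟶ T.G, K.IsExtension T f ∧ ((K.acCond E).and (K.conflictCond E)).Sat M f

theorem isPushout_coprod_inr {C : Type u} [Category.{v} C] [HasBinaryCoproducts C] {A B : C}
    (f : A ⟶ B) (X : C) :
    IsPushout f (coprod.inr : A ⟶ X ⨿ A) (coprod.inr : B ⟶ X ⨿ B) (coprod.map (𝟙 X) f) := by
  refine ⟨⟨by simp⟩, ⟨PushoutCocone.IsColimit.mk _
    (fun s => coprod.desc (coprod.inl ≫ s.inr) s.inl) (fun s => ?_) (fun s => ?_) ?_⟩⟩
  · exact coprod.inr_desc _ _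
  · refine coprod.hom_ext ?_ ?_
    · rw [coprod.inl_map_assoc, Category.id_comp, coprod.inl_desc]
    · rw [coprod.inr_map_assoc, coprod.inr_desc]
      exact s.condition
  · intro s m h₁ h₂
    refine coprod.hom_ext ?_ ?_
    · rw [coprod.inl_desc, ← h₂, coprod.inl_map_assoc, Category.id_comp]
    · rw [coprod.inr_desc, ← h₁]

/-- The pair `R₁ + L₂ ⟸ L₁ + L₂ ⟹ L₁ + R₂` with the coproduct injections as matches. -/
noncomputable def coprodPair {C : Type u} [Category.{v} C] [HasBinaryCoproducts C]
    {M : MorphismProperty C} (ρ₁ ρ₂ : PlainRule M) : TransPair ρ₁ ρ₂ where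
  G := ρ₁.L ⨿ ρ₂.L
  t₁ :=
    { D := ρ₁.K ⨿ ρ₂.L
      H := ρ₁.R ⨿ ρ₂.L
      m := coprod.inl
      k := coprod.inl
      n := coprod.inl
      g := coprod.map ρ₁.l (𝟙 _)
      h := coprod.map ρ₁.r (𝟙 _)
      isPushout_left := (IsPushout.of_coprod_inl_with_id _ _).flip
      isPushout_right := (IsPushout.of_coprod_inl_with_id _ _).flip }
  t₂ :=
    { D := ρ₁.L ⨿ ρ₂.K
      H := ρ₁.L ⨿ ρ₂.R
      m := coprod.inr
      k := coprod.inr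
      n := coprod.inr
      g := coprod.map (𝟙 _) ρ₂.l
      h := coprod.map (𝟙 _) ρ₂.r
      isPushout_left := isPushout_coprod_inr _ _
      isPushout_right := isPushout_coprod_inr _ _ }

/-! ### Rule overlaps -/

/-- An overlap: a span `P₁ ← A → P₂` with morphisms `L₁ ⟶ P₁` and `L₂ ⟶ P₂`. -/
structure Overlap {C : Type u} [Category.{v} C] (L₁ L₂ : C) where
  A : C
  P₁ : C
  P₂ : C
  b₁ : A ⟶ P₁
  b₂ : A ⟶ P₂
  p₁ : L₁ ⟶ P₁
  p₂ : L₂ ⟶ P₂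

/-- Exchange the roles of the two rules. -/
def Overlap.swap {C : Type u} [Category.{v} C] {L₁ L₂ : C} (o : Overlap L₁ L₂) :
    Overlap L₂ L₁ :=
  ⟨o.A, o.P₂, o.P₁, o.b₂, o.b₁, o.p₂, o.p₁⟩

/-- `(f₁, f₂)` is an embedding of the overlap in the pair `T`. -/
def Overlap.IsEmbedding {C : Type u} [Category.{v} C] {M : MorphismProperty C}
    {ρ₁ ρ₂ : PlainRule M} (o : Overlap ρ₁.L ρ₂.L) (T : TransPair ρ₁ ρ₂)
    (f₁ : o.P₁ ⟶ T.G) (f₂ : o.P₂ ⟶ T.G) : Prop :=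
  o.p₁ ≫ f₁ = T.t₁.m ∧ o.p₂ ≫ f₂ = T.t₂.m ∧ IsPullback o.b₁ o.b₂ f₁ f₂

/-- The overlap is a span between the left-hand sides themselves. -/
def Overlap.IsPlain {C : Type u} [Category.{v} C] {L₁ L₂ : C} (o : Overlap L₁ L₂) : Prop :=
  ∃ (A : C) (b₁ : A ⟶ L₁) (b₂ : A ⟶ L₂), o = ⟨A, L₁, L₂, b₁, b₂, 𝟙 L₁, 𝟙 L₂⟩

def Overlap.AcConflicting {C : Type u} [Category.{v} C] {M : MorphismProperty C}
    {ρ₁ ρ₂ : PlainRule M} (o : Overlap ρ₁.L ρ₂.L) : Prop :=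
  ∃ T : TransPair ρ₁ ρ₂, T.ParallelIndependentAcDisregarding ∧
    ∃ (f₁ : o.P₁ ⟶ T.G) (f₂ : o.P₂ ⟶ T.G), o.IsEmbedding T f₁ f₂

/-- `co` is a composition of the overlaps `o` and `o'`. -/
def Overlap.IsComposition {C : Type u} [Category.{v} C] (M : MorphismProperty C)
    (E : CospanClass C) {L₁ L₂ : C} (o o' co : Overlap L₁ L₂) : Prop :=
  ∃ (x : o.P₁ ⟶ co.P₁) (x' : o'.P₁ ⟶ co.P₁) (y : o.P₂ ⟶ co.P₂) (y' : o'.P₂ ⟶ co.P₂)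
    (K : C) (k₁ : co.P₁ ⟶ K) (k₂ : co.P₂ ⟶ K),
    E x x' ∧ E y y' ∧ E k₁ k₂ ∧ M k₁ ∧ M k₂ ∧
    o.p₁ ≫ x = co.p₁ ∧ o'.p₁ ≫ x' = co.p₁ ∧ o.p₂ ≫ y = co.p₂ ∧ o'.p₂ ≫ y' = co.p₂ ∧
    IsPullback co.b₁ co.b₂ k₁ k₂ ∧
    IsPullback o.b₁ o.b₂ (x ≫ k₁) (y ≫ k₂) ∧
    IsPullback o'.b₁ o'.b₂ (x' ≫ k₁) (y' ≫ k₂)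

/-! ### The tree structure of a condition -/

inductive Quantifier
  | ex
  | all

/-- Chains of quantified morphisms that start at a given object. -/
inductive Chain {C : Type u} [Category.{v} C] : C → Type (max u v)
  | nil (P : C) : Chain P
  | cons {P P' : C} (q : Quantifier) (p : P ⟶ P') (t : Chain P') : Chain P

/-- The last object of a chain. -/
def Chain.target {C : Type u} [Category.{v} C] : {P : C} → Chain P → C
  | P, .nil _ => P
  | _, .cons _ _ t => t.target

/-- The composite of a chain. -/
def Chain.comp {C : Type u} [Category.{v} C] : {P : C} → (t : Chain P) → (P ⟶ t.target)
  | P, .nil _ => 𝟙 P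
  | _, .cons _ p t => p ≫ t.comp

/-- `c.HasChild q p d`: an edge `p`, quantified by `q`, leaves the root of the tree of `c`, and
`d` is the condition at its target. -/
inductive Cond.HasChild {C : Type u} [Category.{v} C] :
    {P : C} → Cond P → Quantifier → {P' : C} → (P ⟶ P') → Cond P' → Prop
  | neg {P P' : C} {c : Cond P} {q : Quantifier} {p : P ⟶ P'} {d : Cond P'}
      (hc : c.HasChild q p d) : (Cond.neg c).HasChild q p d
  | conj {P P' : C} {ι : Type (max u v)} {c : ι → Cond P} {q : Quantifier} {p : P ⟶ P'}
      {d : Cond P'} (i : ι) (hc : (c i).HasChild q p d) : (Cond.conj c).HasChild q p d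
  | disj {P P' : C} {ι : Type (max u v)} {c : ι → Cond P} {q : Quantifier} {p : P ⟶ P'}
      {d : Cond P'} (i : ι) (hc : (c i).HasChild q p d) : (Cond.disj c).HasChild q p d
  | ex {P P' : C} (p : P ⟶ P') (d : Cond P') : (Cond.ex p d).HasChild Quantifier.ex p d
  | all {P P' : C} (p : P ⟶ P') (d : Cond P') : (Cond.all p d).HasChild Quantifier.all p d

/-- The chain is a path from the root to a leaf of the tree of the condition. -/
inductive Cond.IsBranch {C : Type u} [Category.{v} C] : {P : C} → Cond P → Chain P → Prop
  | leaf {P : C} (c : Cond P)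
      (hc : ∀ (q : Quantifier) (P' : C) (p : P ⟶ P') (d : Cond P'), ¬ c.HasChild q p d) :
      Cond.IsBranch c (Chain.nil P)
  | cons {P P' : C} {c : Cond P} {q : Quantifier} {p : P ⟶ P'} {d : Cond P'} {t : Chain P'}
      (hc : c.HasChild q p d) (ht : Cond.IsBranch d t) : Cond.IsBranch c (Chain.cons q p t)

/-- The positions in a chain. -/
inductive Chain.Level {C : Type u} [Category.{v} C] : {P : C} → Chain P → Type (max u v)
  | here {P : C} (t : Chain P) : Chain.Level t
  | next {P P' : C} {q : Quantifier} {p : P ⟶ P'} {t : Chain P'} (i : Chain.Level t) :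
      Chain.Level (Chain.cons q p t)

/-- The object `P_i` at a position. -/
def Chain.Level.obj {C : Type u} [Category.{v} C] : {P : C} → {t : Chain P} → t.Level → C
  | P, _, .here _ => P
  | _, _, .next i => i.obj

/-- The composite from the start of the chain to `P_i`. -/
def Chain.Level.path {C : Type u} [Category.{v} C] :
    {P : C} → {t : Chain P} → (i : t.Level) → (P ⟶ i.obj)
  | P, _, .here _ => 𝟙 P
  | _, _, .next (p := p) i => p ≫ i.path

/-- The composite from `P_i` to the end of the chain. -/
def Chain.Level.rest {C : Type u} [Category.{v} C] :
    {P : C} → {t : Chain P} → (i : t.Level) → (i.obj ⟶ t.target)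
  | _, t, .here _ => t.comp
  | _, _, .next i => i.rest

/-- The quantifier that binds `P_i`, where `q₀` is the one that binds the start of the chain. -/
def Chain.Level.binderFrom {C : Type u} [Category.{v} C] :
    {P : C} → {t : Chain P} → Option Quantifier → t.Level → Option Quantifier
  | _, _, q₀, .here _ => q₀
  | _, _, _, .next (q := q) i => i.binderFrom (some q)

/-- The quantifier that binds `P_i`; there is none for the root. -/
def Chain.Level.binder {C : Type u} [Category.{v} C] {P : C} {t : Chain P} (i : t.Level) :
    Option Quantifier :=
  i.binderFrom none

/-! ### Proto-essences and disabling essences -/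

/-- The construction of the proto-essence `ess_l(m₁, m₂)`: the pullback `A` of the two morphisms,
the pullback `A'` of `A` along `l`, and the initial pushout over `A' ⟶ A`. The essence is the span
`(c ≫ a₁, c ≫ a₂)` with essence object `Q`. -/
structure ProtoEssence {C : Type u} [Category.{v} C] (M : MorphismProperty C) {K L P X : C}
    (l : K ⟶ L) (m₁ : L ⟶ X) (m₂ : P ⟶ X) where
  A : C
  A' : C
  B : C
  Q : C
  a₁ : A ⟶ L
  a₂ : A ⟶ P
  k : A' ⟶ A
  a' : A' ⟶ K
  b : B ⟶ A'
  k' : B ⟶ Q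
  c : Q ⟶ A
  isPullback : IsPullback a₁ a₂ m₁ m₂
  isPullback' : IsPullback a' k l a₁
  isInitialPushout : IsInitialPushout M b k' k c

/-- The proto-essence is the pair of morphisms out of the initial object. -/
def ProtoEssence.IsTrivial {C : Type u} [Category.{v} C] {M : MorphismProperty C} {K L P X : C}
    {l : K ⟶ L} {m₁ : L ⟶ X} {m₂ : P ⟶ X} (e : ProtoEssence M l m₁ m₂) : Prop :=
  Nonempty (IsInitial e.Q)

open Classical in
/-- The position at which the recursion along a chain stops: the first one whose proto-essence is
not trivial, or else the last one. -/
noncomputable def Chain.select {C : Type u} [Category.{v} C] (M : MorphismProperty C) {K L X : C}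
    (l : K ⟶ L) (e₁ : L ⟶ X) : {P : C} → (t : Chain P) → (t.target ⟶ X) → t.Level
  | P, .nil _, _ => .here (.nil P)
  | _, .cons q p t, e =>
      if ∃ s : ProtoEssence M l e₁ ((Chain.cons q p t).comp ≫ e), s.IsTrivial then
        .next (t.select M l e₁ e)
      else .here (.cons q p t)

/-- The overlap embeds in some pair of ac-disregarding transformations by a cospan in `E`. -/
def Overlap.EmbedsMinimally {C : Type u} [Category.{v} C] {M : MorphismProperty C}
    (E : CospanClass C) {ρ₁ ρ₂ : PlainRule M} (o : Overlap ρ₁.L ρ₂.L) : Prop :=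
  ∃ (T : TransPair ρ₁ ρ₂) (f₁ : o.P₁ ⟶ T.G) (f₂ : o.P₂ ⟶ T.G),
    E f₁ f₂ ∧ o.IsEmbedding T f₁ f₂

/-- Disabling essences by deletion of `ρ₁` in `ρ₂`, as overlaps. The chain is a path from the root
of the tree of `ac₂` to a leaf, or consists of `L₂` only. -/
def IsDisablingByDeletion {C : Type u} [Category.{v} C] {M : MorphismProperty C}
    (E : CospanClass C) (ρ₁ ρ₂ : Rule M) (o : Overlap ρ₁.L ρ₂.L) : Prop :=
  ∃ (t : Chain ρ₂.L) (X : C) (e₁ : ρ₁.L ⟶ X) (e₂ : t.target ⟶ X),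
    E e₁ e₂ ∧ (t = Chain.nil ρ₂.L ∨ (ρ₂.ac.IsBranch t ∧ M e₂)) ∧
    ∃ i : t.Level, i = t.select M ρ₁.l e₁ e₂ ∧
    (i.binder = none ∨ i.binder = some Quantifier.ex) ∧
    ∃ s : ProtoEssence M ρ₁.l e₁ (i.rest ≫ e₂), ¬ s.IsTrivial ∧
      o = ⟨s.A, ρ₁.L, i.obj, s.a₁, s.a₂, 𝟙 ρ₁.L, i.path⟩ ∧
      o.EmbedsMinimally (ρ₁ := ρ₁.toPlainRule) (ρ₂ := ρ₂.toPlainRule) E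

/-- Disabling essences by insertion of `ρ₁` in `ρ₂`, as overlaps: the proto-essence is computed
with `r₁` in place of `l₁`, starting at the first object after `L₂`, and is then shifted over `ρ₁`,
which replaces `P_i` by the complement `P'` of what `ρ₁` creates. -/
def IsDisablingByInsertion {C : Type u} [Category.{v} C] {M : MorphismProperty C}
    (E : CospanClass C) (ρ₁ ρ₂ : Rule M) (o : Overlap ρ₁.L ρ₂.L) : Prop :=
  ∃ (P₁ : C) (q : Quantifier) (p : ρ₂.L ⟶ P₁) (t : Chain P₁) (X : C) (e₁ : ρ₁.R ⟶ X)
    (e₂ : t.target ⟶ X),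
    E e₁ e₂ ∧ ρ₂.ac.IsBranch (Chain.cons q p t) ∧ M e₂ ∧
    ∃ i : (Chain.cons q p t).Level, i = Chain.Level.next (t.select M ρ₁.r e₁ e₂) ∧
    i.binder = some Quantifier.all ∧
    ∃ s : ProtoEssence M ρ₁.r e₁ (i.rest ≫ e₂), ¬ s.IsTrivial ∧
    ∃ (P' : C) (b' : s.A' ⟶ P') (p' : P' ⟶ i.obj) (pL : ρ₂.L ⟶ P'),
      IsPushout s.k b' s.a₂ p' ∧ pL ≫ p' = i.path ∧
      o = ⟨s.A', ρ₁.L, P', s.a' ≫ ρ₁.l, b', 𝟙 ρ₁.L, pL⟩ ∧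
      o.EmbedsMinimally (ρ₁ := ρ₁.toPlainRule) (ρ₂ := ρ₂.toPlainRule) E

/-- Disabling essences of `ρ₁` in `ρ₂`. -/
def IsDisablingEssence {C : Type u} [Category.{v} C] {M : MorphismProperty C}
    (E : CospanClass C) (ρ₁ ρ₂ : Rule M) (o : Overlap ρ₁.L ρ₂.L) : Prop :=
  IsDisablingByDeletion E ρ₁ ρ₂ o ∨ IsDisablingByInsertion E ρ₁ ρ₂ o

/-! ### Conflict essences -/

/-- `o` is ac-conflicting as an overlap of the rules `ρ₁` and `ρ₂`. -/
def IsAcConflicting {C : Type u} [Category.{v} C] {M : MorphismProperty C} (ρ₁ ρ₂ : Rule M)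
    (o : Overlap ρ₁.L ρ₂.L) : Prop :=
  o.AcConflicting (ρ₁ := ρ₁.toPlainRule) (ρ₂ := ρ₂.toPlainRule)

/-- The set of conflict essences of `ρ₁` and `ρ₂`. -/
inductive IsConflictEssence {C : Type u} [Category.{v} C] {M : MorphismProperty C}
    (E : CospanClass C) (ρ₁ ρ₂ : Rule M) : Overlap ρ₁.L ρ₂.L → Prop
  | first (o : Overlap ρ₁.L ρ₂.L) (ho : IsDisablingEssence E ρ₁ ρ₂ o)
      (hc : IsAcConflicting ρ₁ ρ₂ o ∨ o.IsPlain) : IsConflictEssence E ρ₁ ρ₂ o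
  | second (o : Overlap ρ₂.L ρ₁.L) (ho : IsDisablingEssence E ρ₂ ρ₁ o)
      (hc : IsAcConflicting ρ₁ ρ₂ o.swap ∨ o.swap.IsPlain) : IsConflictEssence E ρ₁ ρ₂ o.swap
  | comp (o o' co : Overlap ρ₁.L ρ₂.L) (ho : IsConflictEssence E ρ₁ ρ₂ o)
      (ho' : IsConflictEssence E ρ₁ ρ₂ o')
      (hc : IsAcConflicting ρ₁ ρ₂ o ↔ IsAcConflicting ρ₁ ρ₂ o')
      (hco : Overlap.IsComposition M E o o' co) : IsConflictEssence E ρ₁ ρ₂ co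

/-! ### Symbolic conflict essences -/

/-- Cospan conditions over two objects. -/
inductive CospanCond {C : Type u} [Category.{v} C] (P P' : C) : Type (max u v + 1)
  | tru : CospanCond P P'
  | neg (c : CospanCond P P') : CospanCond P P'
  | conj {ι : Type (max u v)} (c : ι → CospanCond P P') : CospanCond P P'
  | disj {ι : Type (max u v)} (c : ι → CospanCond P P') : CospanCond P P'
  | ex {P₁ : C} (p : P ⟶ P₁) (p' : P' ⟶ P₁) (d : Cond P₁) : CospanCond P P'

/-- Satisfaction `(q, q') ⊨ c` of a cospan condition. -/
def CospanCond.Sat {C : Type u} [Category.{v} C] (M : MorphismProperty C) {P P' G : C}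
    (q : P ⟶ G) (q' : P' ⟶ G) : CospanCond P P' → Prop
  | .tru => True
  | .neg c => ¬ c.Sat M q q'
  | .conj c => ∀ i, (c i).Sat M q q'
  | .disj c => ∃ i, (c i).Sat M q q'
  | .ex (P₁ := P₁) p p' d => ∃ q₁ : P₁ ⟶ G, d.Sat M q₁ ∧ p ≫ q₁ = q ∧ p' ≫ q₁ = q'

/-- An overlap with a cospan condition over the two objects of its cospan of embeddings. -/
structure SymbolicOverlap {C : Type u} [Category.{v} C] (L₁ L₂ : C) where
  ce : Overlap L₁ L₂
  cond : CospanCond ce.P₁ ce.P₂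

/-- The condition of an ac-conflicting conflict essence: over the pushout `D` of the span, the
conditions of the pair on `L₁ + L₂` shifted along the induced morphism `L₁ + L₂ ⟶ D`. -/
def IsEssenceCond {C : Type u} [Category.{v} C] [HasBinaryCoproducts C] {M : MorphismProperty C}
    (E : CospanClass C) (ρ₁ ρ₂ : Rule M) (o : Overlap ρ₁.L ρ₂.L)
    (cc : CospanCond o.P₁ o.P₂) : Prop :=
  ∃ (D : C) (d₁ : o.P₁ ⟶ D) (d₂ : o.P₂ ⟶ D), IsPushout o.b₁ o.b₂ d₁ d₂ ∧
    cc = .ex d₁ d₂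
      ((((coprodPair ρ₁.toPlainRule ρ₂.toPlainRule).acCond E).and
        ((coprodPair ρ₁.toPlainRule ρ₂.toPlainRule).conflictCond E)).shift M E
        (coprod.desc (o.p₁ ≫ d₁) (o.p₂ ≫ d₂)))

/-- The set of symbolic conflict essences of `ρ₁` and `ρ₂`. -/
def IsSymbolicConflictEssence {C : Type u} [Category.{v} C] [HasBinaryCoproducts C]
    {M : MorphismProperty C} (E : CospanClass C) (ρ₁ ρ₂ : Rule M)
    (s : SymbolicOverlap ρ₁.L ρ₂.L) : Prop :=
  IsConflictEssence E ρ₁ ρ₂ s.ce ∧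
    ((IsAcConflicting ρ₁ ρ₂ s.ce ∧ IsEssenceCond E ρ₁ ρ₂ s.ce s.cond) ∨
      (¬ IsAcConflicting ρ₁ ρ₂ s.ce ∧ s.cond = .tru))

/-- The symbolic overlap is embeddable in `T`: some embedding satisfies its condition. -/
def SymbolicOverlap.EmbedsIn {C : Type u} [Category.{v} C] {M : MorphismProperty C}
    {ρ₁ ρ₂ : PlainRule M} (s : SymbolicOverlap ρ₁.L ρ₂.L) (T : TransPair ρ₁ ρ₂) : Prop :=
  ∃ (f₁ : s.ce.P₁ ⟶ T.G) (f₂ : s.ce.P₂ ⟶ T.G),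
    s.ce.IsEmbedding T f₁ f₂ ∧ s.cond.Sat M f₁ f₂

end ConflictEssence

/-!
The two halves rest on one characterization of the conditions carried by a pair `K`: an extension
morphism `K ⟶ T` satisfies them exactly if `T` is a conflicting pair of transformations
(`TransPair.sat_conditions_iff`). It follows from the semantics of shifts (`Cond.sat_shift`) and of
left translations (`Cond.sat_left`).

For the first half, whether the matches of a pair obstruct each other depends only on the
intersection `L₁ ← W → L₂` of the matches (`IsAdhesiveHLR.factors_iff`, an application of the van
Kampen property), and an embedded overlap determines this intersection. So an overlap is
ac-conflicting or not uniformly for all pairs in which it is embedded. If it is not, these pairs are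
conflicting because of their matches. If it is, the pair on `L₁ + L₂` extends to all of them, and
the condition of the essence says that they are conflicting. Moreover, all pairs with the
intersection `W` are extensions of one pair on the pushout of `L₁ ← W → L₂`
(`Overlap.exists_common_restriction`), hence they have the same initial pair.

For the second half, a conflicting pair of transformations either has a match that is not preserved
by the other transformation, and then the intersection of the matches is a disabling essence; or an
application condition is satisfied before and violated after a transformation. In the latter case,
following the tree of the condition from the root leads to a first object that is existentially
bound and not preserved, or universally bound and newly created (`Cond.exists_obstruction`).
Continuing to a leaf and gluing the rest of the branch to the transformed object gives the cospan
that exhibits a disabling essence. Compositions of essences are not needed for this half.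
-/

namespace ConflictEssence

variable {C : Type u} [Category.{v} C] {M : MorphismProperty C} {E : CospanClass C}

/-! ### Pushouts along `M`-morphisms -/

theorem isPullback_id_of_mono {L X G : C} {a : L ⟶ X} {q : X ⟶ G}
    {m : L ⟶ G} [Mono q] (w : a ≫ q = m) : IsPullback a (𝟙 L) q m :=
  IsPullback.of_vert_isIso_mono ⟨by simp [w]⟩

theorem isPullback_comp_mono_iff {A L P X G : C} {a₁ : A ⟶ L}
    {a₂ : A ⟶ P} {m₁ : L ⟶ X} {m₂ : P ⟶ X} (j : X ⟶ G) [Mono j] :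
    IsPullback a₁ a₂ (m₁ ≫ j) (m₂ ≫ j) ↔ IsPullback a₁ a₂ m₁ m₂ := by
  constructor <;> intro h
  · exact ⟨⟨by simpa [← cancel_mono j] using h.w⟩, ⟨PullbackCone.IsLimit.mk _
      (fun s => h.lift s.fst s.snd (by rw [s.condition_assoc])) (fun s => by simp)
      (fun s => by simp) (fun s m h₁ h₂ => h.hom_ext (by simp [h₁]) (by simp [h₂]))⟩⟩
  · exact ⟨⟨by rw [h.w_assoc]⟩, ⟨PullbackCone.IsLimit.mk _
      (fun s => h.lift s.fst s.snd ((cancel_mono j).1 (by simpa using s.condition)))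
      (fun s => by simp)
      (fun s => by simp) (fun s m h₁ h₂ => h.hom_ext (by simp [h₁]) (by simp [h₂]))⟩⟩

theorem IsAdhesiveHLR.isPullback (hA : IsAdhesiveHLR M) {W X Y Z : C} {f : W ⟶ X} {g : W ⟶ Y}
    {h : X ⟶ Z} {i : Y ⟶ Z} (sq : IsPushout f g h i) (hf : M f) : IsPullback f g h i :=
  have := hA.mono _ hf
  (hA.vanKampen _ _ _ _ sq hf).isPullback_of_mono_left

theorem IsAdhesiveHLR.mem_of_isPushout (hA : IsAdhesiveHLR M) {W X Y Z : C} {f : W ⟶ X}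
    {g : W ⟶ Y} {h : X ⟶ Z} {i : Y ⟶ Z} (sq : IsPushout f g h i) (hf : M f) : M i :=
  have := hA.pushout_mem
  MorphismProperty.of_isPushout sq.flip hf

theorem IsAdhesiveHLR.mem_of_isPullback (hA : IsAdhesiveHLR M) {W X Y Z : C} {f : W ⟶ X}
    {g : W ⟶ Y} {h : X ⟶ Z} {i : Y ⟶ Z} (sq : IsPullback f g h i) (hi : M i) : M f :=
  have := hA.pullback_mem
  MorphismProperty.of_isPullback sq.flip hi

/-- Pushouts along `M`-morphisms are stable under pullback. -/
theorem IsAdhesiveHLR.isPushout_of_isPullback (hA : IsAdhesiveHLR M) {W X Y Z W' X' Y' Z' : C}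
    {f : W ⟶ X} {g : W ⟶ Y} {h : X ⟶ Z} {i : Y ⟶ Z} (sq : IsPushout f g h i) (hf : M f)
    {f' : W' ⟶ X'} {g' : W' ⟶ Y'} {h' : X' ⟶ Z'} {i' : Y' ⟶ Z'} {αW : W' ⟶ W} {αX : X' ⟶ X}
    {αY : Y' ⟶ Y} {αZ : Z' ⟶ Z} (hh : IsPullback h' αX αZ h) (hi : IsPullback i' αY αZ i)
    (hW : IsPullback f' αW αX f) (w₁ : g' ≫ αY = αW ≫ g) (w₂ : f' ≫ h' = g' ≫ i') :
    IsPushout f' g' h' i' := by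
  refine (hA.vanKampen _ _ _ _ sq hf f' g' h' i' αW αX αY αZ hW ?_ ⟨hh.w⟩ ⟨hi.w⟩ ⟨w₂⟩).2 ⟨hh, hi⟩
  have := hW.paste_horiz hh
  rw [sq.w, w₂] at this
  exact IsPullback.of_right this w₁ hi

/-- A morphism `u` into a pushout object along an `M`-morphism `l` factors through the side opposite
to `l` exactly if its intersection with the other side factors through `l`. -/
theorem IsAdhesiveHLR.factors_iff [HasPullbacks C] (hA : IsAdhesiveHLR M) {K L D G V B : C}
    {l : K ⟶ L} {k : K ⟶ D} {m : L ⟶ G} {g : D ⟶ G} (sq : IsPushout l k m g) (hl : M l)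
    {u : V ⟶ G} {b₁ : B ⟶ L} {b₂ : B ⟶ V} (hB : IsPullback b₁ b₂ m u) :
    (∃ x : V ⟶ D, x ≫ g = u) ↔ ∃ y : B ⟶ K, y ≫ l = b₁ := by
  constructor
  · rintro ⟨x, hx⟩
    exact ⟨(hA.isPullback sq hl).lift b₁ (b₂ ≫ x) (by simp [hx, hB.w]), by simp⟩
  · rintro ⟨y, hy⟩
    have := hA.mono _ hl
    have pb := IsPullback.of_hasPullback u g
    have hW : IsPullback (𝟙 B) y b₁ l := (isPullback_id_of_mono hy).flip
    have po := hA.isPushout_of_isPullback sq hl hB.flip pb hW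
      (g' := pb.lift b₂ (y ≫ k) (by simp [← hB.w, ← hy, sq.w])) (by simp) (by simp)
    have := po.isIso_inr_of_isIso
    exact ⟨inv (pullback.fst u g) ≫ pullback.snd u g, by simp [← pullback.condition]⟩

/-- If a pushout along an `M`-morphism factors through a monomorphism `q` on one side, it
decomposes into two pushouts, the second of which is a pullback along `q`. -/
theorem IsAdhesiveHLR.isPushout_decompose (hA : IsAdhesiveHLR M) {K L D G X Z : C}
    {l : K ⟶ L} {k : K ⟶ D} {m : L ⟶ G} {g : D ⟶ G} (sq : IsPushout l k m g) (hl : M l)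
    {a : L ⟶ X} {q : X ⟶ G} [Mono q] (w : a ≫ q = m) {z₁ : Z ⟶ X} {ψ : Z ⟶ D}
    (hZ : IsPullback z₁ ψ q g) :
    ∃ z : K ⟶ Z, z ≫ ψ = k ∧ IsPushout l z a z₁ := by
  refine ⟨hZ.lift (l ≫ a) k (by simp [w, sq.w]), by simp, ?_⟩
  exact hA.isPushout_of_isPullback sq hl (isPullback_id_of_mono w) hZ
    (αW := 𝟙 K) (IsPullback.of_vert_isIso ⟨by simp⟩) (by simp) (by simp)

/-- A pushout complement of `a`, where `a` is the first part of a morphism `a ≫ q` with a pushout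
complement and `q` is a monomorphism, completes to a decomposition of the larger pushout. -/
theorem IsAdhesiveHLR.exists_isPushout_of_complement [HasPullbacks C] (hA : IsAdhesiveHLR M)
    {K L D G X Z : C} {l : K ⟶ L} {k : K ⟶ D} {m : L ⟶ G} {g : D ⟶ G} (sq : IsPushout l k m g)
    (hl : M l) {z : K ⟶ Z} {a : L ⟶ X} {z₁ : Z ⟶ X} (sq' : IsPushout l z a z₁) {q : X ⟶ G}
    [Mono q] (w : a ≫ q = m) :
    ∃ ψ : Z ⟶ D, z ≫ ψ = k ∧ IsPushout z₁ ψ q g := by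
  have pb : IsPullback l z m (z₁ ≫ q) := by
    rw [← w, isPullback_comp_mono_iff]
    exact hA.isPullback sq' hl
  obtain ⟨ψ, hψ⟩ := (hA.factors_iff sq hl pb).2 ⟨𝟙 K, by simp⟩
  have := hA.mono _ (hA.mem_of_isPushout sq hl)
  have hz : z ≫ ψ = k := by
    rw [← cancel_mono g, Category.assoc, hψ, ← sq.w, ← w, ← sq'.w_assoc]
  refine ⟨ψ, hz, ?_⟩
  subst hz w
  exact IsPushout.of_top sq hψ.symm sq'

/-! ### Satisfaction of shifted and translated conditions -/

theorem Cond.sat_and {P G : C} (c d : Cond P) (q : P ⟶ G) :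
    (c.and d).Sat M q ↔ c.Sat M q ∧ d.Sat M q := by
  constructor
  · intro h
    exact ⟨by simpa using h ⟨true⟩, by simpa using h ⟨false⟩⟩
  · rintro ⟨h₁, h₂⟩ ⟨i⟩
    cases i
    · simpa using h₂
    · simpa using h₁

theorem exists_shiftIndex_iff (hA : IsAdhesiveHLR M) (hE : HasPairFactorization E M)
    {P P' P₁ G : C} (b : P ⟶ P') (a : P ⟶ P₁) (q : P' ⟶ G) (Φ : (P₁ ⟶ G) → Prop) :
    (∃ (i : ShiftIndex M E b a) (n : i.X ⟶ G), M n ∧ i.a' ≫ n = q ∧ Φ (i.b' ≫ n)) ↔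
      ∃ q₁ : P₁ ⟶ G, M q₁ ∧ a ≫ q₁ = b ≫ q ∧ Φ q₁ := by
  constructor
  · rintro ⟨i, n, hn, rfl, h⟩
    exact ⟨_, hA.comp_mem _ _ i.b'_mem hn, by rw [← Category.assoc, i.w, Category.assoc], h⟩
  · rintro ⟨q₁, hq₁, w, h⟩
    obtain ⟨W, e, e', n, he, hn, rfl, rfl⟩ := hE.exists_factor q q₁
    have := hA.mono _ hn
    exact ⟨⟨W, e, e', he, hA.of_comp _ _ hq₁ hn, by simpa [← cancel_mono n] using w⟩, n, hn, rfl, h⟩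

theorem Cond.sat_shift (hA : IsAdhesiveHLR M) (hE : HasPairFactorization E M) {P : C}
    (c : Cond P) : ∀ {P' G : C} (b : P ⟶ P') (q : P' ⟶ G),
      (c.shift M E b).Sat M q ↔ c.Sat M (b ≫ q) := by
  induction c with
  | tru => intros; exact Iff.rfl
  | neg c ih => intro P' G b q; exact not_congr (ih b q)
  | conj c ih => intro P' G b q; exact forall_congr' fun i => ih i b q
  | disj c ih => intro P' G b q; exact exists_congr fun i => ih i b q
  | ex a d ih =>
    intro P' G b q
    refine Iff.trans ?_ (exists_shiftIndex_iff hA hE b a q (fun q₁ => d.Sat M q₁))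
    exact exists_congr fun i => exists_congr fun n => and_congr_right' (and_congr_right' (ih _ _))
  | all a d ih =>
    intro P' G b q
    refine Iff.trans ?_ (not_congr (exists_shiftIndex_iff hA hE b a q (fun q₁ => ¬ d.Sat M q₁)))
    rw [not_exists]
    exact forall_congr' fun i => not_congr <| exists_congr fun n =>
      and_congr_right' (and_congr_right' (not_congr (ih _ _)))

/-- The step of a left translation exists whenever the quantified morphism can be mapped into the
result of a transformation that extends the given span. -/
theorem LeftStep.nonempty [HasPullbacks C] (hA : IsAdhesiveHLR M) {G D H X D' H' : C} {g : D ⟶ G}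
    {h : D ⟶ H} (hg : M g) (hh : M h) {d : D ⟶ D'} {e : H ⟶ H'} {h' : D' ⟶ H'}
    (sq : IsPushout h d e h') {a : H ⟶ X} {q : X ⟶ H'} (hq : M q) (w : a ≫ q = e) :
    Nonempty (LeftStep g h a) := by
  have := hA.mono _ hq
  obtain ⟨z, -, po⟩ := hA.isPushout_decompose sq hh w (IsPullback.of_hasPullback q h')
  have := hA.hasPushout g z hg
  exact ⟨⟨_, _, z, _, _, _, po, IsPushout.of_hasPushout g z⟩⟩

/-- One half of the comparison of the two sides of a left translation step: an `M`-morphism out of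
`X` on one side yields one out of `Y` on the other side, over the same pair of pushouts. -/
theorem IsAdhesiveHLR.exists_transfer [HasPullbacks C] (hA : IsAdhesiveHLR M)
    {D G H Z X Y D' G' H' : C} {g : D ⟶ G} {h : D ⟶ H} (hh : M h) {d : D ⟶ D'}
    {f : G ⟶ G'} {e : H ⟶ H'} {g' : D' ⟶ G'} {h' : D' ⟶ H'} (sq : IsPushout g d f g')
    (sq' : IsPushout h d e h') {z : D ⟶ Z} {a : H ⟶ X} {x : Z ⟶ X} {y : G ⟶ Y} {y' : Z ⟶ Y}
    (c : IsPushout h z a x) (c' : IsPushout g z y y') {q : X ⟶ H'} (hq : M q) (w : a ≫ q = e) :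
    ∃ (γ : Y ⟶ G') (ψ : Z ⟶ D'), M γ ∧ y ≫ γ = f ∧ IsPushout y' ψ γ g' ∧ IsPushout x ψ q h' := by
  have := hA.mono _ hq
  obtain ⟨ψ, hψ, po⟩ := hA.exists_isPushout_of_complement sq' hh c w
  have hx : M x := hA.mem_of_isPushout c hh
  have hψM : M ψ := hA.mem_of_isPullback (hA.isPullback po hx).flip hq
  have comm : g ≫ f = z ≫ ψ ≫ g' := by rw [sq.w, reassoc_of% hψ]
  have po' : IsPushout y' ψ (c'.desc f (ψ ≫ g') comm) g' := by
    refine IsPushout.of_top (h₁₁ := g) (v₁₁ := z) (v₁₂ := y) ?_ (by simp) c'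
    simpa [hψ] using sq
  exact ⟨_, ψ, hA.mem_of_isPushout po'.flip hψM, by simp, po', po⟩

theorem Cond.sat_left [HasPullbacks C] (hA : IsAdhesiveHLR M) {H : C} (c : Cond H) :
    ∀ {G D G' D' H' : C} {g : D ⟶ G} {h : D ⟶ H} {f : G ⟶ G'} {d : D ⟶ D'} {e : H ⟶ H'}
      {g' : D' ⟶ G'} {h' : D' ⟶ H'}, M g → M h → IsPushout g d f g' → IsPushout h d e h' →
      ((c.left g h).Sat M f ↔ c.Sat M e) := by
  have key : ∀ {H X : C} {a : H ⟶ X} {Φ : ∀ {G' : C}, (X ⟶ G') → Prop}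
      {Ψ : ∀ {Y Z : C} (y' : Z ⟶ Y) (x : Z ⟶ X) {G' : C}, (Y ⟶ G') → Prop}
      (_ : ∀ {G D G' D' H' : C} {g : D ⟶ G} {h : D ⟶ X} {f : G ⟶ G'} {d : D ⟶ D'} {e : X ⟶ H'}
        {g' : D' ⟶ G'} {h' : D' ⟶ H'}, M g → M h → IsPushout g d f g' → IsPushout h d e h' →
        (Ψ g h f ↔ Φ e))
      {G D G' D' H' : C} {g : D ⟶ G} {h : D ⟶ H} {f : G ⟶ G'} {d : D ⟶ D'} {e : H ⟶ H'}
      {g' : D' ⟶ G'} {h' : D' ⟶ H'}, M g → M h → IsPushout g d f g' → IsPushout h d e h' →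
      ∀ s : LeftStep g h a, ((∃ γ : s.Y ⟶ G', M γ ∧ s.y ≫ γ = f ∧ Ψ s.g' s.h' γ) ↔
        ∃ q : X ⟶ H', M q ∧ a ≫ q = e ∧ Φ q) := by
    -- Stated for arbitrary properties `Φ` and `Ψ` in place of satisfaction, so that it serves the
    -- universal quantifier (with negated properties) as well as the existential one.
    intro H X a Φ Ψ hΦ G D G' D' H' g h f d e g' h' hg hh sq sq' s
    have hg' := hA.mem_of_isPushout s.isPushout hg
    have hh' := hA.mem_of_isPushout s.complement hh
    constructor
    · rintro ⟨γ, hγ, w, hs⟩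
      obtain ⟨q, ψ, hq, w', po, po'⟩ :=
        hA.exists_transfer hg sq' sq s.isPushout s.complement hγ w
      exact ⟨q, hq, w', (hΦ hg' hh' po' po).1 hs⟩
    · rintro ⟨q, hq, w, hs⟩
      obtain ⟨γ, ψ, hγ, w', po, po'⟩ :=
        hA.exists_transfer hh sq sq' s.complement s.isPushout hq w
      exact ⟨γ, hγ, w', (hΦ hg' hh' po po').2 hs⟩
  induction c with
  | tru => intros; exact Iff.rfl
  | neg c ih => intros; exact not_congr (ih ‹_› ‹_› ‹_› ‹_›)
  | conj c ih => intros; exact forall_congr' fun i => ih i ‹_› ‹_› ‹_› ‹_›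
  | disj c ih => intros; exact exists_congr fun i => ih i ‹_› ‹_› ‹_› ‹_›
  | ex a c ih =>
    intro G D G' D' H' g h f d e g' h' hg hh sq sq'
    by_cases s : Nonempty (LeftStep g h a)
    · rw [Cond.left, dif_pos s]
      exact key (Φ := fun q => c.Sat M q) (Ψ := fun y' x _ γ => (c.left y' x).Sat M γ) ih
        hg hh sq sq' s.some
    · rw [Cond.left, dif_neg s]
      refine iff_of_false (fun h => h trivial) ?_
      rintro ⟨q, hq, w, -⟩
      exact s (LeftStep.nonempty hA hg hh sq' hq w)
  | all a c ih =>
    intro G D G' D' H' g h f d e g' h' hg hh sq sq'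
    by_cases s : Nonempty (LeftStep g h a)
    · rw [Cond.left, dif_pos s]
      exact not_congr (key (Φ := fun q => ¬ c.Sat M q)
        (Ψ := fun y' x _ γ => ¬ (c.left y' x).Sat M γ)
        (fun a b c d => not_congr (ih a b c d)) hg hh sq sq' s.some)
    · rw [Cond.left, dif_neg s]
      refine iff_of_true trivial ?_
      rintro ⟨q, hq, w, -⟩
      exact s (LeftStep.nonempty hA hg hh sq' hq w)

/-! ### Extension diagrams -/

theorem Transformation.g_mem (hA : IsAdhesiveHLR M) {ρ : PlainRule M} {G : C}
    (t : Transformation ρ G) : M t.g :=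
  hA.mem_of_isPushout t.isPushout_left ρ.l_mem

theorem Transformation.h_mem (hA : IsAdhesiveHLR M) {ρ : PlainRule M} {G : C}
    (t : Transformation ρ G) : M t.h :=
  hA.mem_of_isPushout t.isPushout_right ρ.r_mem

/-- A morphism of pushout complements extends to an extension diagram. -/
theorem Transformation.isExtension_of_hom {ρ : PlainRule M} {G G' : C} (t : Transformation ρ G)
    (t' : Transformation ρ G') {f : G ⟶ G'} (hm : t.m ≫ f = t'.m) {d : t.D ⟶ t'.D}
    (hk : t.k ≫ d = t'.k) (hg : d ≫ t'.g = t.g ≫ f) : t.IsExtension t' f := by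
  have w : ρ.r ≫ t'.n = t.k ≫ d ≫ t'.h := by rw [t'.isPushout_right.w, reassoc_of% hk]
  refine ⟨hm, d, t.isPushout_right.desc t'.n (d ≫ t'.h) w, hk, by simp, ?_, ?_⟩
  · refine IsPushout.of_top ?_ hg.symm t.isPushout_left
    rw [hk, hm]
    exact t'.isPushout_left
  · refine IsPushout.of_top (h₁₁ := ρ.r) (v₁₁ := t.k) (v₁₂ := t.n) ?_ (by simp) t.isPushout_right
    simpa [hk] using t'.isPushout_right

theorem Transformation.IsExtension.refl {ρ : PlainRule M} {G : C} (t : Transformation ρ G) :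
    t.IsExtension t (𝟙 G) :=
  t.isExtension_of_hom t (by simp) (d := 𝟙 _) (by simp) (by simp)

theorem Transformation.IsExtension.trans {ρ : PlainRule M} {G G' G'' : C} {t : Transformation ρ G}
    {t' : Transformation ρ G'} {t'' : Transformation ρ G''} {f : G ⟶ G'} {f' : G' ⟶ G''}
    (h : t.IsExtension t' f) (h' : t'.IsExtension t'' f') : t.IsExtension t'' (f ≫ f') := by
  obtain ⟨hm, d, e, hk, hn, po, po'⟩ := h
  obtain ⟨hm', d', e', hk', hn', pos, pos'⟩ := h'
  exact t.isExtension_of_hom t'' (by rw [reassoc_of% hm, hm']) (d := d ≫ d')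
    (by rw [reassoc_of% hk, hk']) (by rw [Category.assoc, ← pos.w, po.w_assoc])

theorem TransPair.IsExtension.refl {ρ₁ ρ₂ : PlainRule M} (T : TransPair ρ₁ ρ₂) :
    T.IsExtension T (𝟙 _) :=
  ⟨.refl _, .refl _⟩

theorem TransPair.IsExtension.trans {ρ₁ ρ₂ : PlainRule M} {T T' T'' : TransPair ρ₁ ρ₂}
    {f : T.G ⟶ T'.G} {f' : T'.G ⟶ T''.G} (h : T.IsExtension T' f) (h' : T'.IsExtension T'' f') :
    T.IsExtension T'' (f ≫ f') :=
  ⟨h.1.trans h'.1, h.2.trans h'.2⟩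

/-- A transformation restricts along a monomorphism through which its match factors. -/
theorem Transformation.exists_restrict [HasPullbacks C] (hA : IsAdhesiveHLR M) {ρ : PlainRule M}
    {X G : C} (t : Transformation ρ G) {a : ρ.L ⟶ X} {j : X ⟶ G} [Mono j] (w : a ≫ j = t.m) :
    ∃ t₀ : Transformation ρ X, t₀.m = a := by
  obtain ⟨z, -, po⟩ :=
    hA.isPushout_decompose t.isPushout_left ρ.l_mem w (IsPullback.of_hasPullback j t.g)
  have := hA.hasPushout ρ.r z ρ.r_mem
  exact ⟨⟨_, _, a, z, _, _, _, po, IsPushout.of_hasPushout ρ.r z⟩, rfl⟩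

/-- Transformations with the same match are isomorphic: pushout complements along `M`-morphisms are
unique. -/
theorem Transformation.isExtension_id_of_match_eq [HasPullbacks C] (hA : IsAdhesiveHLR M)
    {ρ : PlainRule M} {G : C} (t t' : Transformation ρ G) (h : t.m = t'.m) :
    t.IsExtension t' (𝟙 G) := by
  obtain ⟨ψ, hψ, po⟩ := hA.exists_isPushout_of_complement t'.isPushout_left ρ.l_mem
    t.isPushout_left (q := 𝟙 G) (by simp [h])
  exact t.isExtension_of_hom t' (by simp [h]) hψ po.w.symm

/-- A transformation restricts to the pushout of the intersection of its match with any other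
morphism. The pushout complement is assembled from the interface of the rule and from the part of
the other object that the transformation preserves. -/
theorem Transformation.exists_restrict_pushout [HasPullbacks C] [HasInitial C] (hC : Setting M E)
    {ρ : PlainRule M} {G A P Q : C} (t : Transformation ρ G) {b₁ : A ⟶ ρ.L} {b₂ : A ⟶ P}
    {u : P ⟶ G} (pb : IsPullback b₁ b₂ t.m u) {d₁ : ρ.L ⟶ Q} {d₂ : P ⟶ Q}
    (po : IsPushout b₁ b₂ d₁ d₂) :
    ∃ t₀ : Transformation ρ Q, t₀.m = d₁ ∧ t₀.IsExtension t (po.desc t.m u pb.w) := by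
  have hA := hC.adhesive
  have hW := IsPullback.of_hasPullback b₁ ρ.l
  have hi := IsPullback.of_hasPullback u t.g
  have w : (pullback.fst b₁ ρ.l ≫ b₂) ≫ u = (pullback.snd b₁ ρ.l ≫ t.k) ≫ t.g := by
    rw [Category.assoc, ← pb.w, hW.w_assoc, t.isPushout_left.w, Category.assoc]
  -- The pushout of `t` pulled back along `u`.
  have po₁ : IsPushout (pullback.fst b₁ ρ.l) (hi.lift _ _ w) b₂ (pullback.fst u t.g) :=
    hA.isPushout_of_isPullback t.isPushout_left ρ.l_mem pb.flip hi hW (by simp) (by simp)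
  have := hC.boundedPushouts (pullback.snd b₁ ρ.l) (hi.lift _ _ w) t.k (pullback.snd u t.g)
    (by simp)
  have po₂ := IsPushout.of_hasPushout (pullback.snd b₁ ρ.l) (hi.lift _ _ w)
  have po₃ := po₁.paste_horiz po
  rw [hW.w] at po₃
  have po₄ : IsPushout ρ.l (pushout.inl _ _) d₁
      (po₂.desc (ρ.l ≫ d₁) (pullback.fst u t.g ≫ d₂) (by simpa using po₃.w)) := by
    refine IsPushout.of_left (h₁₁ := pullback.snd b₁ ρ.l) (v₁₁ := hi.lift _ _ w) ?_ (by simp) po₂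
    simpa using po₃
  have := hA.hasPushout ρ.r (pushout.inl (pullback.snd b₁ ρ.l) (hi.lift _ _ w)) ρ.r_mem
  let t₀ : Transformation ρ Q :=
    ⟨_, _, d₁, pushout.inl _ _, _, _, _, po₄, IsPushout.of_hasPushout ρ.r (pushout.inl _ _)⟩
  refine ⟨t₀, rfl, t₀.isExtension_of_hom t (by simp [t₀])
    (d := po₂.desc t.k (pullback.snd u t.g) (by simp)) (by simp [t₀]) ?_⟩
  apply po₂.hom_ext
  · simp [t₀, t.isPushout_left.w]
  · simp [t₀, pullback.condition]

/-! ### Initial transformation pairs -/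

/-- A pair that is initial for `T` is initial for every pair that extends to `T`; in particular, it
extends to each such pair. -/
theorem TransPair.IsInitialFor.of_isExtension {ρ₁ ρ₂ : PlainRule M}
    {I S T : TransPair ρ₁ ρ₂} (hI : I.IsInitialFor T) {x : S.G ⟶ T.G} (hx : S.IsExtension T x) :
    I.IsInitialFor S := by
  obtain ⟨f, -, hu⟩ := hI
  obtain ⟨y, ⟨hy, rfl⟩, huy⟩ := hu S x hx
  refine ⟨y, hy, fun S' x' hx' => ?_⟩
  obtain ⟨z, ⟨hz, hzx⟩, huz⟩ := hu S' (x' ≫ x) (hx'.trans hx)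
  refine ⟨z, ⟨hz, huy _ ⟨hz.trans hx', by simpa using hzx⟩⟩, ?_⟩
  rintro z' ⟨hz', rfl⟩
  exact huz _ ⟨hz', by simp⟩

/-- Initial pairs for the same pair are isomorphic. -/
theorem TransPair.IsInitialFor.isIsomorphic {ρ₁ ρ₂ : PlainRule M} {I J T : TransPair ρ₁ ρ₂}
    (hI : I.IsInitialFor T) (hJ : J.IsInitialFor T) : I.IsIsomorphic J := by
  obtain ⟨f, hf, hfu⟩ := hI
  obtain ⟨g, hg, hgu⟩ := hJ
  obtain ⟨y, ⟨hy, hyg⟩, -⟩ := hfu J g hg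
  obtain ⟨z, ⟨hz, hzf⟩, -⟩ := hgu I f hf
  have h₁ : y ≫ z = 𝟙 _ := (hfu I f hf).unique ⟨hy.trans hz, by simp [hzf, hyg]⟩
    ⟨.refl I, by simp⟩
  have h₂ : z ≫ y = 𝟙 _ := (hgu J g hg).unique ⟨hz.trans hy, by simp [hzf, hyg]⟩
    ⟨.refl J, by simp⟩
  exact ⟨⟨y, z, h₁, h₂⟩, hy, hz⟩

/-! ### Parallel independence and the conflict condition -/

theorem Transformation.sat_preservationCond [HasPullbacks C] (hA : IsAdhesiveHLR M)
    (hE : HasPairFactorization E M) {ρ : Rule M} {G G' L : C}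
    {t : Transformation ρ.toPlainRule G} {t' : Transformation ρ.toPlainRule G'} {f : G ⟶ G'}
    (hf : t.IsExtension t' f) (m : L ⟶ G) (ac : Cond L) :
    (t.preservationCond E m ac).Sat M f ↔
      ∃ d : L ⟶ t'.D, d ≫ t'.g = m ≫ f ∧ ac.Sat M (d ≫ t'.h) := by
  obtain ⟨hm, d, e, hk, hn, po, po'⟩ := hf
  have := hA.mono _ (t'.g_mem hA)
  unfold preservationCond
  split_ifs with hd
  · have hc := hd.choose_spec
    generalize hd.choose = x at hc ⊢
    rw [Cond.sat_left hA _ (t.g_mem hA) (t.h_mem hA) po po', Cond.sat_shift hA hE,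
      Category.assoc, po'.w]
    constructor
    · intro h
      exact ⟨x ≫ d, by rw [Category.assoc, ← po.w, reassoc_of% hc], by simpa using h⟩
    · rintro ⟨y, hy, h⟩
      have : y = x ≫ d := by rw [← cancel_mono t'.g, hy, Category.assoc, ← po.w, reassoc_of% hc]
      simpa [this] using h
  · refine iff_of_false (fun h => h trivial) ?_
    rintro ⟨y, hy, -⟩
    exact hd ⟨(hA.isPullback po (t.g_mem hA)).flip.lift y m hy, by simp⟩

/-- An extension morphism from `K` to `T` satisfies the two conditions of `K` exactly if `T` is a
conflicting pair of transformations. -/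
theorem TransPair.sat_conditions_iff [HasPullbacks C] (hA : IsAdhesiveHLR M)
    (hE : HasPairFactorization E M) {ρ₁ ρ₂ : Rule M}
    {K T : TransPair ρ₁.toPlainRule ρ₂.toPlainRule} {f : K.G ⟶ T.G} (hf : K.IsExtension T f) :
    ((K.acCond E).and (K.conflictCond E)).Sat M f ↔ T.IsValid ∧ ¬ T.ParallelIndependent := by
  rw [Cond.sat_and]
  refine and_congr ?_ (not_congr ?_)
  · unfold acCond IsValid
    rw [Cond.sat_and, Cond.sat_shift hA hE, Cond.sat_shift hA hE, hf.1.1, hf.2.1]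
  · unfold ParallelIndependent
    rw [Cond.sat_and, Transformation.sat_preservationCond hA hE hf.1,
      Transformation.sat_preservationCond hA hE hf.2, hf.1.1, hf.2.1]

/-- The pair of coproduct injections extends to every pair that is parallel independent when
application conditions are disregarded. -/
theorem coprodPair_isExtension [HasBinaryCoproducts C] {ρ₁ ρ₂ : PlainRule M}
    {T : TransPair ρ₁ ρ₂} (hT : T.ParallelIndependentAcDisregarding) :
    (coprodPair ρ₁ ρ₂).IsExtension T (coprod.desc T.t₁.m T.t₂.m) := by
  obtain ⟨⟨d₁, h₁⟩, d₂, h₂⟩ := hT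
  constructor
  · refine Transformation.isExtension_of_hom _ _ (coprod.inl_desc _ _)
      (d := coprod.desc T.t₁.k d₁) (coprod.inl_desc _ _) ?_
    apply coprod.hom_ext <;> simp [coprodPair, h₁, T.t₁.isPushout_left.w]
  · refine Transformation.isExtension_of_hom _ _ (coprod.inr_desc _ _)
      (d := coprod.desc d₂ T.t₂.k) (coprod.inr_desc _ _) ?_
    apply coprod.hom_ext <;> simp [coprodPair, h₂, T.t₂.isPushout_left.w]

/-! ### Embedded overlaps -/

/-- The span `L₁ ← W → L₂` obtained by pulling an overlap back to the left-hand sides is the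
intersection of the matches in every pair in which the overlap is embedded. -/
theorem Overlap.exists_matchPullback [HasPullbacks C] {L₁ L₂ : C} (o : Overlap L₁ L₂) :
    ∃ (W : C) (w₁ : W ⟶ L₁) (w₂ : W ⟶ L₂), ∀ {G : C} (f₁ : o.P₁ ⟶ G) (f₂ : o.P₂ ⟶ G),
      IsPullback o.b₁ o.b₂ f₁ f₂ → IsPullback w₁ w₂ (o.p₁ ≫ f₁) (o.p₂ ≫ f₂) := by
  refine ⟨pullback (pullback.snd o.p₁ o.b₁ ≫ o.b₂) o.p₂,
    pullback.fst _ _ ≫ pullback.fst _ _, pullback.snd _ _, fun f₁ f₂ h => ?_⟩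
  exact (IsPullback.of_hasPullback _ _).paste_horiz
    ((IsPullback.of_hasPullback o.p₁ o.b₁).paste_vert h)

theorem Overlap.parallelIndependentAcDisregarding_congr [HasPullbacks C] (hA : IsAdhesiveHLR M)
    {ρ₁ ρ₂ : PlainRule M} {T T' : TransPair ρ₁ ρ₂} {o : Overlap ρ₁.L ρ₂.L}
    {f₁ : o.P₁ ⟶ T.G} {f₂ : o.P₂ ⟶ T.G} (h : o.IsEmbedding T f₁ f₂)
    {f₁' : o.P₁ ⟶ T'.G} {f₂' : o.P₂ ⟶ T'.G} (h' : o.IsEmbedding T' f₁' f₂') :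
    T.ParallelIndependentAcDisregarding ↔ T'.ParallelIndependentAcDisregarding := by
  obtain ⟨W, w₁, w₂, hW⟩ := o.exists_matchPullback
  obtain ⟨hm₁, hm₂, hpb⟩ := h
  obtain ⟨hm₁', hm₂', hpb'⟩ := h'
  have pb := hW _ _ hpb
  have pb' := hW _ _ hpb'
  rw [hm₁, hm₂] at pb
  rw [hm₁', hm₂'] at pb'
  unfold TransPair.ParallelIndependentAcDisregarding
  rw [hA.factors_iff T.t₁.isPushout_left ρ₁.l_mem pb,
    hA.factors_iff T.t₂.isPushout_left ρ₂.l_mem pb.flip,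
    hA.factors_iff T'.t₁.isPushout_left ρ₁.l_mem pb',
    hA.factors_iff T'.t₂.isPushout_left ρ₂.l_mem pb'.flip]

/-- Two pairs in which the same overlap is embedded are extensions of a common pair, on the pushout
of the intersection of the matches. -/
theorem Overlap.exists_common_restriction [HasPullbacks C] [HasInitial C] (hC : Setting M E)
    {ρ₁ ρ₂ : PlainRule M} {T T' : TransPair ρ₁ ρ₂} {o : Overlap ρ₁.L ρ₂.L}
    {f₁ : o.P₁ ⟶ T.G} {f₂ : o.P₂ ⟶ T.G} (h : o.IsEmbedding T f₁ f₂)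
    {f₁' : o.P₁ ⟶ T'.G} {f₂' : o.P₂ ⟶ T'.G} (h' : o.IsEmbedding T' f₁' f₂') :
    ∃ (S : TransPair ρ₁ ρ₂) (x : S.G ⟶ T.G) (x' : S.G ⟶ T'.G),
      S.IsExtension T x ∧ S.IsExtension T' x' := by
  have hA := hC.adhesive
  obtain ⟨W, w₁, w₂, hW⟩ := o.exists_matchPullback
  obtain ⟨hm₁, hm₂, hpb⟩ := h
  obtain ⟨hm₁', hm₂', hpb'⟩ := h'
  have pb := hW _ _ hpb
  have pb' := hW _ _ hpb'
  rw [hm₁, hm₂] at pb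
  rw [hm₁', hm₂'] at pb'
  have := hC.boundedPushouts _ _ _ _ pb.w
  have po := IsPushout.of_hasPushout w₁ w₂
  obtain ⟨s₁, hs₁, e₁⟩ := T.t₁.exists_restrict_pushout hC pb po
  obtain ⟨s₂, hs₂, e₂⟩ := T.t₂.exists_restrict_pushout hC pb.flip po.flip
  obtain ⟨s₁', hs₁', e₁'⟩ := T'.t₁.exists_restrict_pushout hC pb' po
  obtain ⟨s₂', hs₂', e₂'⟩ := T'.t₂.exists_restrict_pushout hC pb'.flip po.flip
  have i₁ := (s₁.isExtension_id_of_match_eq hA s₁' (by rw [hs₁, hs₁'])).trans e₁'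
  have i₂ := (s₂.isExtension_id_of_match_eq hA s₂' (by rw [hs₂, hs₂'])).trans e₂'
  have c : po.flip.desc T.t₂.m T.t₁.m pb.flip.w = po.desc T.t₁.m T.t₂.m pb.w :=
    po.hom_ext (by simp) (by simp)
  have c' : po.flip.desc T'.t₂.m T'.t₁.m pb'.flip.w = po.desc T'.t₁.m T'.t₂.m pb'.w :=
    po.hom_ext (by simp) (by simp)
  rw [c] at e₂
  rw [Category.id_comp] at i₁ i₂
  rw [c'] at i₂
  exact ⟨⟨_, s₁, s₂⟩, _, _, ⟨e₁, e₂⟩, ⟨i₁, i₂⟩⟩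

/-- In a pair that is parallel independent up to application conditions, the condition of an
ac-conflicting essence expresses that the pair is a conflicting pair of transformations. -/
theorem sat_essenceCond_iff [HasPullbacks C] [HasBinaryCoproducts C] (hA : IsAdhesiveHLR M)
    (hE : HasPairFactorization E M) {ρ₁ ρ₂ : Rule M} {T : TransPair ρ₁.toPlainRule ρ₂.toPlainRule}
    (hT : T.ParallelIndependentAcDisregarding) {D : C} {m₁ : ρ₁.L ⟶ D} {m₂ : ρ₂.L ⟶ D}
    {q : D ⟶ T.G} (h₁ : m₁ ≫ q = T.t₁.m) (h₂ : m₂ ≫ q = T.t₂.m) :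
    ((((coprodPair ρ₁.toPlainRule ρ₂.toPlainRule).acCond E).and
      ((coprodPair ρ₁.toPlainRule ρ₂.toPlainRule).conflictCond E)).shift M E
        (coprod.desc m₁ m₂)).Sat M q ↔ T.IsValid ∧ ¬ T.ParallelIndependent := by
  refine (Cond.sat_shift hA hE _ _ _).trans ?_
  refine Iff.trans ?_ (TransPair.sat_conditions_iff hA hE (coprodPair_isExtension hT))
  have h : coprod.desc m₁ m₂ ≫ q = coprod.desc T.t₁.m T.t₂.m := by
    apply coprod.hom_ext <;> simp [h₁, h₂]
  exact iff_of_eq (congrArg _ h)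

/-- A symbolic conflict essence is embedded only in conflicting pairs of transformations: for an
overlap that is not ac-conflicting the matches already are in conflict, and otherwise the condition
of the essence expresses the conflict. -/
theorem IsSymbolicConflictEssence.not_parallelIndependent [HasPullbacks C] [HasInitial C]
    [HasBinaryCoproducts C] (hC : Setting M E) {ρ₁ ρ₂ : Rule M}
    {s : SymbolicOverlap ρ₁.L ρ₂.L} (hs : IsSymbolicConflictEssence E ρ₁ ρ₂ s)
    {T : TransPair ρ₁.toPlainRule ρ₂.toPlainRule}
    (hT : SymbolicOverlap.EmbedsIn (ρ₁ := ρ₁.toPlainRule) (ρ₂ := ρ₂.toPlainRule) s T) :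
    ¬ T.ParallelIndependent := by
  obtain ⟨f₁, f₂, he, hsat⟩ := hT
  rcases hs.2 with ⟨⟨T₀, hT₀, g₁, g₂, he₀⟩, D, d₁, d₂, po, hc⟩ | ⟨hn, -⟩
  · rw [hc] at hsat
    obtain ⟨q, hq, h₁, h₂⟩ := hsat
    have hpi := (Overlap.parallelIndependentAcDisregarding_congr hC.adhesive he he₀).2 hT₀
    exact ((sat_essenceCond_iff hC.adhesive hC.factorization hpi
      (by rw [Category.assoc, h₁, he.1]) (by rw [Category.assoc, h₂, he.2.1])).1 hq).2
  · rintro ⟨⟨x, hx, -⟩, y, hy, -⟩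
    exact hn ⟨T, ⟨⟨x, hx⟩, y, hy⟩, f₁, f₂, he⟩

/-! ### Trivial proto-essences -/

/-- An initial pushout has an initial context exactly over isomorphisms. -/
theorem IsInitialPushout.nonempty_isInitial_iff [HasInitial C] (hC : Setting M E)
    {B A Q A' : C} {b : B ⟶ A} {k' : B ⟶ Q} {k : A ⟶ A'} {c : Q ⟶ A'}
    (h : IsInitialPushout M b k' k c) (hk : M k) : Nonempty (IsInitial Q) ↔ IsIso k := by
  have hA := hC.adhesive
  constructor
  · rintro ⟨hQ⟩
    have := hA.mono _ (hA.mem_of_isPullback (hA.isPullback h.isPushout h.boundary_mem).flip hk)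
    have : IsIso k' :=
      have : IsSplitEpi k' := ⟨⟨⟨hQ.to B, hQ.hom_ext _ _⟩⟩⟩
      isIso_of_mono_of_isSplitEpi k'
    exact h.isPushout.isIso_inl_of_isIso
  · intro
    -- Over an isomorphism, the square on the initial object is a pushout.
    obtain ⟨⟨p, p'⟩, ⟨-, hp', -⟩, -⟩ := h.initial (initial.to A) (𝟙 (⊥_ C)) (initial.to A')
      (hC.initial_mem _) (IsPushout.of_vert_isIso ⟨initialIsInitial.hom_ext _ _⟩)
    have := hA.mono _ hp'
    have : IsSplitEpi p' := ⟨⟨⟨initial.to Q, initialIsInitial.hom_ext _ _⟩⟩⟩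
    have := isIso_of_mono_of_isSplitEpi p'
    exact ⟨initialIsInitial.ofIso (asIso p').symm⟩

theorem ProtoEssence.nonempty [HasPullbacks C] [HasInitial C] (hC : Setting M E) {K L P X : C}
    {l : K ⟶ L} (hl : M l) (m₁ : L ⟶ X) (m₂ : P ⟶ X) : Nonempty (ProtoEssence M l m₁ m₂) := by
  have pb := IsPullback.of_hasPullback l (pullback.fst m₁ m₂)
  obtain ⟨B, Q, b, k', c, h⟩ :=
    hC.initialPushouts _ (hC.adhesive.mem_of_isPullback pb.flip hl)
  exact ⟨⟨_, _, B, Q, _, _, _, _, b, k', c, IsPullback.of_hasPullback m₁ m₂, pb, h⟩⟩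

/-- The proto-essence of a match and a morphism `f` is trivial exactly if the transformation
preserves the image of `f`. -/
theorem ProtoEssence.isTrivial_iff [HasPullbacks C] [HasInitial C] (hC : Setting M E)
    {K L D G P X : C} {l : K ⟶ L} {k : K ⟶ D} {m : L ⟶ G} {g : D ⟶ G} (sq : IsPushout l k m g)
    (hl : M l) {e₁ : L ⟶ X} {e₂ : P ⟶ X} (s : ProtoEssence M l e₁ e₂) {f : P ⟶ G}
    (pb : IsPullback s.a₁ s.a₂ m f) : s.IsTrivial ↔ ∃ x : P ⟶ D, x ≫ g = f := by
  have hA := hC.adhesive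
  have hk : M s.k := hA.mem_of_isPullback s.isPullback'.flip hl
  have := hA.mono _ hk
  rw [hA.factors_iff sq hl pb]
  refine (s.isInitialPushout.nonempty_isInitial_iff hC hk).trans ⟨fun _ => ?_, ?_⟩
  · exact ⟨inv s.k ≫ s.a', by simp [s.isPullback'.w]⟩
  · rintro ⟨y, hy⟩
    have : IsSplitEpi s.k := ⟨⟨⟨s.isPullback'.lift y (𝟙 _) (by simp [hy]), by simp⟩⟩⟩
    exact isIso_of_mono_of_isSplitEpi _

theorem ProtoEssence.isPullback_of_comp {K L G P X G' : C} {l : K ⟶ L} {m : L ⟶ G} {e₁ : L ⟶ X}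
    {e₂ : P ⟶ X} (s : ProtoEssence M l e₁ e₂) {f : P ⟶ G} {j : X ⟶ G'} {ι : G ⟶ G'} [Mono j]
    [Mono ι] (h₁ : e₁ ≫ j = m ≫ ι) (h₂ : e₂ ≫ j = f ≫ ι) : IsPullback s.a₁ s.a₂ m f := by
  rw [← isPullback_comp_mono_iff ι, ← h₁, ← h₂, isPullback_comp_mono_iff]
  exact s.isPullback

/-! ### Levels of a chain -/

theorem Chain.Level.path_rest {P : C} {t : Chain P} (i : t.Level) : i.path ≫ i.rest = t.comp := by
  induction i with
  | here t => exact Category.id_comp _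
  | next i ih => exact (Category.assoc _ _ _).trans (congrArg _ ih)

/-- For a morphism `f` from the object at a level to `G`: the induced morphisms from all earlier
objects of the chain to `G` factor through `g`. -/
def Chain.Level.FactorsBefore {D G : C} (g : D ⟶ G) :
    {P : C} → {t : Chain P} → (i : t.Level) → (i.obj ⟶ G) → Prop
  | _, _, .here _, _ => True
  | P, _, .next (p := p) i, f =>
      (∃ x : P ⟶ D, x ≫ g = p ≫ i.path ≫ f) ∧ i.FactorsBefore g f

/-- The first level with a non-trivial proto-essence is the first one whose object is not preserved
by the transformation. The monomorphisms `j` and `ι` compare the object `X` of the cospan with the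
object `G` that is transformed. -/
theorem Chain.eq_select [HasPullbacks C] [HasInitial C] (hC : Setting M E)
    {K L D G X G' : C} {l : K ⟶ L} {k : K ⟶ D} {m : L ⟶ G} {g : D ⟶ G} (sq : IsPushout l k m g)
    (hl : M l) {e₁ : L ⟶ X} {j : X ⟶ G'} {ι : G ⟶ G'} [Mono j] [Mono ι] (h₁ : e₁ ≫ j = m ≫ ι)
    {P : C} {t : Chain P} (i : t.Level) : ∀ (e : t.target ⟶ X) (f : i.obj ⟶ G),
      i.rest ≫ e ≫ j = f ≫ ι → i.FactorsBefore g f → (¬ ∃ x : i.obj ⟶ D, x ≫ g = f) →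
        i = t.select M l e₁ e := by
  induction i with
  | here t =>
    intro e f w _ hf
    cases t with
    | nil => rfl
    | cons q p t =>
      rw [Chain.select, if_neg]
      rintro ⟨s, hs⟩
      exact hf ((s.isTrivial_iff hC sq hl (s.isPullback_of_comp h₁
        ((Category.assoc _ _ _).trans w))).1 hs)
  | @next P P' q p t i ih =>
    rintro e f w ⟨hx, hb⟩ hf
    rw [Chain.select, if_pos, ← ih e f w hb hf]
    obtain ⟨s⟩ := ProtoEssence.nonempty hC hl e₁ ((Chain.cons q p t).comp ≫ e)
    refine ⟨s, (s.isTrivial_iff hC sq hl (s.isPullback_of_comp h₁ ?_)).2 hx⟩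
    have h := (Chain.Level.next (q := q) (p := p) i).path_rest
    rw [← h]
    refine (Category.assoc _ _ _).trans ((Category.assoc _ _ _).trans ?_)
    refine (congrArg (fun z => (p ≫ i.path) ≫ z) w).trans ?_
    exact ((Category.assoc _ _ _).trans (congrArg _ (Category.assoc _ _ _).symm)).trans
      (Category.assoc _ _ _).symm

/-! ### Lost satisfaction of a condition -/

/-- Induction along the edges of the tree of a condition. -/
theorem Cond.childInduction {motive : ∀ {P : C}, Cond P → Prop}
    (h : ∀ {P : C} (c : Cond P),
      (∀ {q : Quantifier} {P' : C} {p : P ⟶ P'} {d : Cond P'}, c.HasChild q p d → motive d) →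
        motive c) {P : C} (c : Cond P) : motive c := by
  refine h c ?_
  induction c with
  | tru => intro q P' p d hc; cases hc
  | neg c ih => intro q P' p d hc; cases hc with | neg hc => exact ih hc
  | conj c ih => intro q P' p d hc; cases hc with | conj i hc => exact ih i hc
  | disj c ih => intro q P' p d hc; cases hc with | disj i hc => exact ih i hc
  | ex a c ih => intro q P' p d hc; cases hc; exact h _ ih
  | all a c ih => intro q P' p d hc; cases hc; exact h _ ih

theorem Cond.IsStrictNormal.isNormal {P : C} {c : Cond P} (h : c.IsStrictNormal M) :
    c.IsNormal M := by
  induction c with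
  | tru => trivial
  | neg c ih => exact h
  | conj c ih => exact fun i => ih i (h i)
  | disj c ih => exact fun i => ih i (h i)
  | ex a c ih => exact h.2
  | all a c ih => exact h.2

theorem Cond.HasChild.isStrictNormal {P P' : C} {c : Cond P} {q : Quantifier} {p : P ⟶ P'}
    {d : Cond P'} (hc : c.HasChild q p d) (h : c.IsNormal M) : d.IsStrictNormal M := by
  induction hc with
  | neg hc ih => rw [show _ = Cond.tru from h] at hc; cases hc
  | conj i hc ih => exact ih (h i)
  | disj i hc ih => exact ih (h i)
  | ex p d => exact h.2
  | all p d => exact h.2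

theorem Cond.HasChild.mem {P P' : C} {c : Cond P} {q : Quantifier} {p : P ⟶ P'}
    {d : Cond P'} (hc : c.HasChild q p d) (h : c.IsStrictNormal M) : M p := by
  induction hc with
  | neg hc ih => rw [show _ = Cond.tru from h] at hc; cases hc
  | conj i hc ih => exact ih (h i)
  | disj i hc ih => exact ih (h i)
  | ex p d => exact h.1
  | all p d => exact h.1

theorem Cond.exists_isBranch (hA : IsAdhesiveHLR M) {P : C} (c : Cond P) :
    c.IsStrictNormal M → ∃ t : Chain P, c.IsBranch t ∧ M t.comp := by
  induction c using Cond.childInduction with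
  | h c ih =>
    intro hc
    by_cases h : ∃ (q : Quantifier) (P' : C) (p : _ ⟶ P') (d : Cond P'), c.HasChild q p d
    · obtain ⟨q, P', p, d, hd⟩ := h
      obtain ⟨t, ht, htm⟩ := ih hd (hd.isStrictNormal hc.isNormal)
      exact ⟨_, .cons hd ht, hA.comp_mem _ _ (hd.mem hc) htm⟩
    · exact ⟨_, .leaf c fun q P' p d hd => h ⟨q, P', p, d, hd⟩, hA.iso_mem _ (.id _)⟩

/-- If `δ ≫ g` satisfies a condition but `δ ≫ h` does not, then at some edge of the tree of the
condition an existential witness in `G` does not factor through `g`, or a universal counterexample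
in `H` does not factor through `h`, or else the same happens at the target of the edge. -/
theorem Cond.exists_child_of_sat_of_not_sat (hA : IsAdhesiveHLR M) {G D H : C} {g : D ⟶ G}
    {h : D ⟶ H} (hg : M g) (hh : M h) {P : C} (c : Cond P) (hc : c.IsNormal M) (δ : P ⟶ D)
    (hs : c.Sat M (δ ≫ g)) (hn : ¬ c.Sat M (δ ≫ h)) :
    ∃ (q : Quantifier) (P' : C) (p : P ⟶ P') (d : Cond P'), c.HasChild q p d ∧
      ((q = .ex ∧ ∃ f : P' ⟶ G, M f ∧ p ≫ f = δ ≫ g ∧ ¬ ∃ x : P' ⟶ D, x ≫ g = f) ∨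
       (q = .all ∧ ∃ f : P' ⟶ H, M f ∧ p ≫ f = δ ≫ h ∧ ¬ ∃ x : P' ⟶ D, x ≫ h = f) ∨
       ∃ δ' : P' ⟶ D, p ≫ δ' = δ ∧ d.Sat M (δ' ≫ g) ∧ ¬ d.Sat M (δ' ≫ h)) := by
  have := hA.mono _ hg
  have := hA.mono _ hh
  induction c with
  | tru => exact absurd trivial hn
  | neg c ih =>
    cases (show c = .tru from hc)
    exact absurd trivial hs
  | conj c ih =>
    obtain ⟨i, hi⟩ := not_forall.1 hn
    obtain ⟨q, P', p, d, hd, h'⟩ := ih i (hc i) δ (hs i) hi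
    exact ⟨q, P', p, d, .conj i hd, h'⟩
  | disj c ih =>
    obtain ⟨i, hi⟩ := hs
    obtain ⟨q, P', p, d, hd, h'⟩ := ih i (hc i) δ hi fun h => hn ⟨i, h⟩
    exact ⟨q, P', p, d, .disj i hd, h'⟩
  | @ex P P' a c ih =>
    obtain ⟨f, hf, w, hsf⟩ := hs
    refine ⟨_, P', a, c, .ex a c, ?_⟩
    by_cases hx : ∃ x : P' ⟶ D, x ≫ g = f
    · obtain ⟨x, rfl⟩ := hx
      have hw : a ≫ x = δ := by simpa [← cancel_mono g] using w
      exact .inr (.inr ⟨x, hw, hsf, fun h' => hn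
        ⟨_, hA.comp_mem _ _ (hA.of_comp _ _ hf hg) hh, by rw [reassoc_of% hw], h'⟩⟩)
    · exact .inl ⟨rfl, f, hf, w, hx⟩
  | @all P P' a c ih =>
    obtain ⟨f, hf, w, hsf⟩ := not_not.1 hn
    refine ⟨_, P', a, c, .all a c, ?_⟩
    by_cases hx : ∃ x : P' ⟶ D, x ≫ h = f
    · obtain ⟨x, rfl⟩ := hx
      have hw : a ≫ x = δ := by simpa [← cancel_mono h] using w
      exact .inr (.inr ⟨x, hw, by_contra fun h' => hs
        ⟨_, hA.comp_mem _ _ (hA.of_comp _ _ hf hh) hg, by rw [reassoc_of% hw], h'⟩, hsf⟩)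
    · exact .inr (.inl ⟨rfl, f, hf, w, hx⟩)

/-- A place in the tree of a condition `c` at which satisfaction is obstructed along `g : D ⟶ G`: a
branch, a level bound by `Q`, and an `M`-morphism from the object at that level to `G` which is the
first one along the branch that does not factor through `g`. -/
structure Cond.Obstruction (M : MorphismProperty C) {D G : C} (g : D ⟶ G) (Q : Quantifier) {P : C}
    (c : Cond P) (δ : P ⟶ D) where
  t : Chain P
  isBranch : c.IsBranch t
  i : t.Level
  f : i.obj ⟶ G
  f_mem : M f
  rest_mem : M i.rest
  w : i.path ≫ f = δ ≫ g
  binder : ∀ q₀, i.binderFrom q₀ = some Q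
  factorsBefore : i.FactorsBefore g f
  not_factors : ¬ ∃ x : i.obj ⟶ D, x ≫ g = f

/-- An obstruction right below the root, continued to a leaf along an arbitrary branch. -/
theorem Cond.HasChild.obstruction (hA : IsAdhesiveHLR M) {D G P P' : C} {g : D ⟶ G}
    {Q : Quantifier} {c : Cond P} {p : P ⟶ P'} {d : Cond P'} (hc : c.HasChild Q p d)
    (hd : d.IsStrictNormal M) {δ : P ⟶ D} {f : P' ⟶ G} (hf : M f) (w : p ≫ f = δ ≫ g)
    (hn : ¬ ∃ x : P' ⟶ D, x ≫ g = f) : Nonempty (c.Obstruction M g Q δ) := by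
  obtain ⟨t, ht, htm⟩ := d.exists_isBranch hA hd
  refine ⟨⟨_, .cons hc ht, .next (.here t), f, hf, htm, ?_, fun _ => rfl, ⟨⟨δ, ?_⟩, trivial⟩, hn⟩⟩
  · exact (congrArg (· ≫ f) (Category.comp_id p)).trans w
  · exact w.symm.trans (congrArg (p ≫ ·) (Category.id_comp f).symm)

theorem Cond.Obstruction.cons {D G P P' : C} {g : D ⟶ G} {q Q : Quantifier} {c : Cond P}
    {p : P ⟶ P'} {d : Cond P'} (hc : c.HasChild q p d) {δ : P ⟶ D} {δ' : P' ⟶ D} (w : p ≫ δ' = δ)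
    (o : d.Obstruction M g Q δ') : Nonempty (c.Obstruction M g Q δ) := by
  have hw : p ≫ o.i.path ≫ o.f = δ ≫ g := by rw [o.w, reassoc_of% w]
  exact ⟨⟨_, .cons hc o.isBranch, .next o.i, o.f, o.f_mem, o.rest_mem,
    (Category.assoc _ _ _).trans hw, fun _ => o.binder _, ⟨⟨δ, hw.symm⟩, o.factorsBefore⟩,
    o.not_factors⟩⟩

/-- If `δ ≫ g` satisfies a condition in normal form but `δ ≫ h` does not, then this is due to an
existentially bound object not preserved along `g`, or to a universally bound one not reflected
along `h`. -/
theorem Cond.exists_obstruction (hA : IsAdhesiveHLR M) {G D H : C} {g : D ⟶ G} {h : D ⟶ H}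
    (hg : M g) (hh : M h) {P : C} (c : Cond P) : c.IsNormal M → ∀ δ : P ⟶ D,
      c.Sat M (δ ≫ g) → ¬ c.Sat M (δ ≫ h) →
        Nonempty (c.Obstruction M g .ex δ) ∨ Nonempty (c.Obstruction M h .all δ) := by
  induction c using Cond.childInduction with
  | h c ih =>
    intro hc δ hs hn
    obtain ⟨q, P', p, d, hd, h'⟩ := c.exists_child_of_sat_of_not_sat hA hg hh hc δ hs hn
    have hdn : d.IsStrictNormal M := hd.isStrictNormal hc
    rcases h' with ⟨rfl, f, hf, w, hx⟩ | ⟨rfl, f, hf, w, hx⟩ | ⟨δ', w, hs', hn'⟩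
    · exact .inl (hd.obstruction hA hdn hf w hx)
    · exact .inr (hd.obstruction hA hdn hf w hx)
    · rcases ih hd hdn.isNormal δ' hs' hn' with ⟨⟨o⟩⟩ | ⟨⟨o⟩⟩
      · exact .inl (o.cons hd w)
      · exact .inr (o.cons hd w)

/-! ### Disabling essences of conflicting pairs -/

/-- An embedded overlap is also embedded by a cospan in `E`: the pair restricts to the object of
the factorized cospan. -/
theorem Overlap.IsEmbedding.embedsMinimally [HasPullbacks C] [HasInitial C] (hC : Setting M E)
    {ρ₁ ρ₂ : PlainRule M} {T : TransPair ρ₁ ρ₂} {o : Overlap ρ₁.L ρ₂.L}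
    {f₁ : o.P₁ ⟶ T.G} {f₂ : o.P₂ ⟶ T.G} (h : o.IsEmbedding T f₁ f₂) :
    o.EmbedsMinimally (ρ₁ := ρ₁) (ρ₂ := ρ₂) E := by
  have hA := hC.adhesive
  obtain ⟨h₁, h₂, pb⟩ := h
  obtain ⟨X, e₁, e₂, j, he, hj, rfl, rfl⟩ := hC.factorization.exists_factor f₁ f₂
  have := hA.mono _ hj
  obtain ⟨t₁, ht₁⟩ := T.t₁.exists_restrict hA (a := o.p₁ ≫ e₁) (j := j) (by simpa using h₁)
  obtain ⟨t₂, ht₂⟩ := T.t₂.exists_restrict hA (a := o.p₂ ≫ e₂) (j := j) (by simpa using h₂)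
  exact ⟨⟨X, t₁, t₂⟩, e₁, e₂, he, ht₁.symm, ht₂.symm, (isPullback_comp_mono_iff j).1 pb⟩

/-- If the second match is not preserved by the first transformation, then the intersection of the
matches is a disabling essence by deletion. -/
theorem exists_disablingEssence_of_not_factors [HasPullbacks C] [HasInitial C] (hC : Setting M E)
    {ρ₁ ρ₂ : Rule M} {T : TransPair ρ₁.toPlainRule ρ₂.toPlainRule}
    (hT : ¬ ∃ d : ρ₂.L ⟶ T.t₁.D, d ≫ T.t₁.g = T.t₂.m) :
    ∃ (o : Overlap ρ₁.L ρ₂.L) (f₁ : o.P₁ ⟶ T.G) (f₂ : o.P₂ ⟶ T.G),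
      IsDisablingEssence E ρ₁ ρ₂ o ∧ o.IsPlain ∧
        o.IsEmbedding (ρ₁ := ρ₁.toPlainRule) (ρ₂ := ρ₂.toPlainRule) T f₁ f₂ := by
  have hA := hC.adhesive
  obtain ⟨X, e₁, e₂, j, he, hj, h₁, h₂⟩ := hC.factorization.exists_factor T.t₁.m T.t₂.m
  have := hA.mono _ hj
  obtain ⟨s⟩ := ProtoEssence.nonempty hC ρ₁.l_mem e₁
    ((Chain.Level.here (Chain.nil ρ₂.L)).rest ≫ e₂)
  have pb : IsPullback s.a₁ s.a₂ T.t₁.m T.t₂.m :=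
    s.isPullback_of_comp (ι := 𝟙 _) (by simpa using h₁)
      ((congrArg (· ≫ j) (Category.id_comp e₂)).trans (h₂.trans (Category.comp_id _).symm))
  have hs : ¬ s.IsTrivial := fun hs =>
    hT ((s.isTrivial_iff hC T.t₁.isPushout_left ρ₁.l_mem pb).1 hs)
  have hemb : Overlap.IsEmbedding (ρ₁ := ρ₁.toPlainRule) (ρ₂ := ρ₂.toPlainRule)
      ⟨s.A, ρ₁.L, ρ₂.L, s.a₁, s.a₂, 𝟙 _, 𝟙 _⟩ T T.t₁.m T.t₂.m :=
    ⟨Category.id_comp _, Category.id_comp _, pb⟩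
  exact ⟨⟨s.A, ρ₁.L, ρ₂.L, s.a₁, s.a₂, 𝟙 _, 𝟙 _⟩, T.t₁.m, T.t₂.m,
    .inl ⟨.nil ρ₂.L, X, e₁, e₂, he, .inl rfl, .here _, rfl, .inl rfl, s, hs, rfl,
      hemb.embedsMinimally hC⟩, ⟨_, _, _, rfl⟩, hemb⟩

/-- The cospan of a match and an obstructing morphism, extended to the leaf of the branch: gluing
the remaining part of the branch to the transformed object and factorizing yields a cospan in `E`
whose proto-essences agree with the intersections in the transformed object. -/
theorem exists_cospan_extension [HasPullbacks C] [HasInitial C] (hC : Setting M E) {L P P' G : C}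
    (m : L ⟶ G) {f : P ⟶ G} (hf : M f) {r : P ⟶ P'} (hr : M r) :
    ∃ (X G' : C) (e₁ : L ⟶ X) (e₂ : P' ⟶ X) (j : X ⟶ G') (ι : G ⟶ G'), E e₁ e₂ ∧ M e₂ ∧
      Mono j ∧ Mono ι ∧ e₁ ≫ j = m ≫ ι ∧ r ≫ e₂ ≫ j = f ≫ ι := by
  have hA := hC.adhesive
  have := hA.hasPushout r f hr
  have po := IsPushout.of_hasPushout r f
  obtain ⟨X, e₁, e₂, j, he, hj, h₁, h₂⟩ :=
    hC.factorization.exists_factor (m ≫ pushout.inr r f) (pushout.inl r f)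
  refine ⟨X, _, e₁, e₂, j, pushout.inr r f, he, hA.of_comp _ j ?_ hj, hA.mono _ hj,
    hA.mono _ (hA.mem_of_isPushout po hr), h₁, by rw [h₂, po.w]⟩
  rw [h₂]
  exact hA.mem_of_isPushout po.flip hf

/-- An object required by `ac₂` and deleted by `ρ₁` yields a disabling essence by deletion. -/
theorem exists_disablingEssence_of_deletion [HasPullbacks C] [HasInitial C] (hC : Setting M E)
    {ρ₁ ρ₂ : Rule M} {T : TransPair ρ₁.toPlainRule ρ₂.toPlainRule} {d : ρ₂.L ⟶ T.t₁.D}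
    (hd : d ≫ T.t₁.g = T.t₂.m) (ob : ρ₂.ac.Obstruction M T.t₁.g .ex d) :
    ∃ (o : Overlap ρ₁.L ρ₂.L) (f₁ : o.P₁ ⟶ T.G) (f₂ : o.P₂ ⟶ T.G),
      IsDisablingEssence E ρ₁ ρ₂ o ∧
        o.IsEmbedding (ρ₁ := ρ₁.toPlainRule) (ρ₂ := ρ₂.toPlainRule) T f₁ f₂ := by
  obtain ⟨t, hb, i, f, hf, hr, w, hq, hfb, hn⟩ := ob
  obtain ⟨X, G', e₁, e₂, j, ι, he, he₂, _, _, h₁, h₂⟩ :=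
    exists_cospan_extension hC T.t₁.m hf hr
  obtain ⟨s⟩ := ProtoEssence.nonempty hC ρ₁.l_mem e₁ (i.rest ≫ e₂)
  have pb : IsPullback s.a₁ s.a₂ T.t₁.m f := s.isPullback_of_comp h₁ (by simpa using h₂)
  have hs : ¬ s.IsTrivial := fun hs =>
    hn ((s.isTrivial_iff hC T.t₁.isPushout_left ρ₁.l_mem pb).1 hs)
  have hemb : Overlap.IsEmbedding (ρ₁ := ρ₁.toPlainRule) (ρ₂ := ρ₂.toPlainRule)
      ⟨s.A, ρ₁.L, i.obj, s.a₁, s.a₂, 𝟙 _, i.path⟩ T T.t₁.m f :=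
    ⟨Category.id_comp _, w.trans hd, pb⟩
  exact ⟨_, T.t₁.m, f, .inl ⟨t, X, e₁, e₂, he, .inr ⟨hb, he₂⟩, i,
    Chain.eq_select hC T.t₁.isPushout_left ρ₁.l_mem h₁ i e₂ f h₂ hfb hn, .inr (hq _), s, hs,
    rfl, hemb.embedsMinimally hC⟩, hemb⟩

/-- An object forbidden by `ac₂` and created by `ρ₁` yields a disabling essence by insertion. Its
complement is the part of the object that is already present before the transformation. -/
theorem exists_disablingEssence_of_insertion [HasPullbacks C] [HasInitial C] (hC : Setting M E)
    {ρ₁ ρ₂ : Rule M} {T : TransPair ρ₁.toPlainRule ρ₂.toPlainRule} {d : ρ₂.L ⟶ T.t₁.D}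
    (hd : d ≫ T.t₁.g = T.t₂.m) (ob : ρ₂.ac.Obstruction M T.t₁.h .all d) :
    ∃ (o : Overlap ρ₁.L ρ₂.L) (f₁ : o.P₁ ⟶ T.G) (f₂ : o.P₂ ⟶ T.G),
      IsDisablingEssence E ρ₁ ρ₂ o ∧
        o.IsEmbedding (ρ₁ := ρ₁.toPlainRule) (ρ₂ := ρ₂.toPlainRule) T f₁ f₂ := by
  have hA := hC.adhesive
  obtain ⟨t, hb, i, f, hf, hr, w, hq, hfb, hn⟩ := ob
  cases i with
  | here => cases hq none
  | @next _ P₁ q p t i =>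
    obtain ⟨X, G', e₁, e₂, j, ι, he, he₂, _, _, h₁, h₂⟩ :=
      exists_cospan_extension hC T.t₁.n hf hr
    obtain ⟨s⟩ := ProtoEssence.nonempty hC ρ₁.r_mem e₁
      ((Chain.Level.next (q := q) (p := p) i).rest ≫ e₂)
    have pb : IsPullback s.a₁ s.a₂ T.t₁.n f := s.isPullback_of_comp h₁ (by simpa using h₂)
    have hs : ¬ s.IsTrivial := fun hs =>
      hn ((s.isTrivial_iff hC T.t₁.isPushout_right ρ₁.r_mem pb).1 hs)
    have hi := IsPullback.of_hasPullback f T.t₁.h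
    have wb : (s.k ≫ s.a₂) ≫ f = (s.a' ≫ T.t₁.k) ≫ T.t₁.h := by
      rw [Category.assoc, ← pb.w, ← s.isPullback'.w_assoc, T.t₁.isPushout_right.w, Category.assoc]
    have po : IsPushout s.k (hi.lift _ _ wb) s.a₂ (pullback.fst f T.t₁.h) :=
      hA.isPushout_of_isPullback T.t₁.isPushout_right ρ₁.r_mem pb.flip hi s.isPullback'.flip
        (by simp) (by simp)
    have pb₁ : IsPullback (hi.lift _ _ wb) s.a' (pullback.snd f T.t₁.h) T.t₁.k := by
      refine IsPullback.of_right ?_ (by simp) hi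
      rw [hi.lift_fst, ← T.t₁.isPushout_right.w]
      exact s.isPullback'.flip.paste_horiz pb.flip
    have pb₂ := pb₁.flip.paste_horiz (hA.isPullback T.t₁.isPushout_left ρ₁.l_mem)
    have hemb : Overlap.IsEmbedding (ρ₁ := ρ₁.toPlainRule) (ρ₂ := ρ₂.toPlainRule)
        ⟨s.A', ρ₁.L, pullback f T.t₁.h, s.a' ≫ ρ₁.l, hi.lift _ _ wb, 𝟙 _, hi.lift _ _ w⟩ T
        T.t₁.m (pullback.snd f T.t₁.h ≫ T.t₁.g) :=
      ⟨Category.id_comp _, by simp [hd], pb₂⟩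
    exact ⟨_, T.t₁.m, pullback.snd f T.t₁.h ≫ T.t₁.g, .inr ⟨P₁, q, p, t, X, e₁, e₂, he, hb, he₂,
      .next i, congrArg _ (Chain.eq_select hC T.t₁.isPushout_right ρ₁.r_mem h₁ i e₂ f h₂ hfb.2 hn),
      hq _, s, hs, _, _, _, _, po, hi.lift_fst _ _ _, rfl, hemb.embedsMinimally hC⟩, hemb⟩

theorem exists_disablingEssence_of_not_sat [HasPullbacks C] [HasInitial C] (hC : Setting M E)
    {ρ₁ ρ₂ : Rule M} {T : TransPair ρ₁.toPlainRule ρ₂.toPlainRule} (hT : ρ₂.ac.Sat M T.t₂.m)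
    {d : ρ₂.L ⟶ T.t₁.D} (hd : d ≫ T.t₁.g = T.t₂.m) (hn : ¬ ρ₂.ac.Sat M (d ≫ T.t₁.h)) :
    ∃ (o : Overlap ρ₁.L ρ₂.L) (f₁ : o.P₁ ⟶ T.G) (f₂ : o.P₂ ⟶ T.G),
      IsDisablingEssence E ρ₁ ρ₂ o ∧
        o.IsEmbedding (ρ₁ := ρ₁.toPlainRule) (ρ₂ := ρ₂.toPlainRule) T f₁ f₂ := by
  have hA := hC.adhesive
  rw [← hd] at hT
  rcases ρ₂.ac.exists_obstruction hA (T.t₁.g_mem hA) (T.t₁.h_mem hA) ρ₂.ac_normal d hT hn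
    with ⟨⟨ob⟩⟩ | ⟨⟨ob⟩⟩
  · exact exists_disablingEssence_of_deletion hC hd ob
  · exact exists_disablingEssence_of_insertion hC hd ob

/-! ### Conflict essences of conflicting pairs -/

/-- The pair with the roles of the two transformations exchanged. -/
def TransPair.swap {ρ₁ ρ₂ : PlainRule M} (T : TransPair ρ₁ ρ₂) : TransPair ρ₂ ρ₁ :=
  ⟨T.G, T.t₂, T.t₁⟩

theorem Overlap.IsEmbedding.swap {ρ₁ ρ₂ : PlainRule M} {T : TransPair ρ₁ ρ₂}
    {o : Overlap ρ₂.L ρ₁.L} {f₁ : o.P₁ ⟶ T.G} {f₂ : o.P₂ ⟶ T.G}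
    (h : o.IsEmbedding T.swap f₁ f₂) : o.swap.IsEmbedding T f₂ f₁ :=
  ⟨h.2.1, h.1, h.2.2.flip⟩

theorem Overlap.IsPlain.swap {L₁ L₂ : C} {o : Overlap L₁ L₂} (h : o.IsPlain) :
    o.swap.IsPlain := by
  obtain ⟨A, b₁, b₂, rfl⟩ := h
  exact ⟨A, b₂, b₁, rfl⟩

/-- Some disabling essence of one rule in the other one is embedded in each conflicting pair of
transformations. -/
theorem exists_conflictEssence [HasPullbacks C] [HasInitial C] (hC : Setting M E)
    {ρ₁ ρ₂ : Rule M} {T : TransPair ρ₁.toPlainRule ρ₂.toPlainRule} (hT : T.IsValid)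
    (hn : ¬ T.ParallelIndependent) :
    ∃ (o : Overlap ρ₁.L ρ₂.L) (f₁ : o.P₁ ⟶ T.G) (f₂ : o.P₂ ⟶ T.G),
      IsConflictEssence E ρ₁ ρ₂ o ∧
        o.IsEmbedding (ρ₁ := ρ₁.toPlainRule) (ρ₂ := ρ₂.toPlainRule) T f₁ f₂ := by
  by_cases h₁ : ∃ d : ρ₂.L ⟶ T.t₁.D, d ≫ T.t₁.g = T.t₂.m
  swap
  · obtain ⟨o, f₁, f₂, ho, hp, he⟩ := exists_disablingEssence_of_not_factors hC h₁
    exact ⟨o, f₁, f₂, .first o ho (.inr hp), he⟩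
  by_cases h₂ : ∃ d : ρ₁.L ⟶ T.t₂.D, d ≫ T.t₂.g = T.t₁.m
  swap
  · obtain ⟨o, f₁, f₂, ho, hp, he⟩ := exists_disablingEssence_of_not_factors hC (T := T.swap) h₂
    exact ⟨o.swap, f₂, f₁, .second o ho (.inr hp.swap), he.swap⟩
  obtain ⟨d₁, hd₁⟩ := h₁
  obtain ⟨d₂, hd₂⟩ := h₂
  have hpi : T.ParallelIndependentAcDisregarding := ⟨⟨d₁, hd₁⟩, d₂, hd₂⟩
  by_cases hs₁ : ρ₂.ac.Sat M (d₁ ≫ T.t₁.h)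
  · have hs₂ : ¬ ρ₁.ac.Sat M (d₂ ≫ T.t₂.h) := fun hs₂ =>
      hn ⟨⟨d₁, hd₁, hs₁⟩, d₂, hd₂, hs₂⟩
    obtain ⟨o, f₁, f₂, ho, he⟩ :=
      exists_disablingEssence_of_not_sat hC (T := T.swap) hT.1 hd₂ hs₂
    exact ⟨o.swap, f₂, f₁, .second o ho (.inl ⟨T, hpi, f₂, f₁, he.swap⟩), he.swap⟩
  · obtain ⟨o, f₁, f₂, ho, he⟩ := exists_disablingEssence_of_not_sat hC hT.2 hd₁ hs₁
    exact ⟨o, f₁, f₂, .first o ho (.inl ⟨T, hpi, f₁, f₂, he⟩), he⟩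

theorem exists_symbolicConflictEssence [HasPullbacks C] [HasInitial C] [HasBinaryCoproducts C]
    (hC : Setting M E) {ρ₁ ρ₂ : Rule M} {T : TransPair ρ₁.toPlainRule ρ₂.toPlainRule}
    (hT : T.IsValid) (hn : ¬ T.ParallelIndependent) :
    ∃ s : SymbolicOverlap ρ₁.L ρ₂.L, IsSymbolicConflictEssence E ρ₁ ρ₂ s ∧
      SymbolicOverlap.EmbedsIn (ρ₁ := ρ₁.toPlainRule) (ρ₂ := ρ₂.toPlainRule) s T := by
  obtain ⟨o, f₁, f₂, ho, he⟩ := exists_conflictEssence hC hT hn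
  by_cases hac : IsAcConflicting ρ₁ ρ₂ o
  · obtain ⟨T₀, hT₀, g₁, g₂, he₀⟩ := id hac
    have hpi := (Overlap.parallelIndependentAcDisregarding_congr hC.adhesive he he₀).2 hT₀
    have := hC.boundedPushouts _ _ _ _ he.2.2.w
    have po := IsPushout.of_hasPushout o.b₁ o.b₂
    refine ⟨⟨o, .ex (pushout.inl _ _) (pushout.inr _ _)
      ((((coprodPair ρ₁.toPlainRule ρ₂.toPlainRule).acCond E).and
        ((coprodPair ρ₁.toPlainRule ρ₂.toPlainRule).conflictCond E)).shift M E
          (coprod.desc (o.p₁ ≫ pushout.inl _ _) (o.p₂ ≫ pushout.inr _ _)))⟩,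
      ⟨ho, .inl ⟨hac, _, _, _, po, rfl⟩⟩, f₁, f₂, he,
      po.desc f₁ f₂ he.2.2.w, ?_, po.inl_desc _ _ _, po.inr_desc _ _ _⟩
    exact (sat_essenceCond_iff hC.adhesive hC.factorization hpi (by simp [he.1])
      (by simp [he.2.1])).2 ⟨hT, hn⟩
  · exact ⟨⟨o, .tru⟩, ⟨ho, .inr ⟨hac, rfl⟩⟩, f₁, f₂, he, trivial⟩

end ConflictEssence

theorem mainTheorem2 {C : Type u} [Category.{v} C] [HasPullbacks C] [HasInitial C]
    [HasBinaryCoproducts C] (M : MorphismProperty C) (E : ConflictEssence.CospanClass C)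
    (hC : ConflictEssence.Setting M E) (ρ₁ ρ₂ : ConflictEssence.Rule M) :
    (∀ s : ConflictEssence.SymbolicOverlap ρ₁.L ρ₂.L,
      ConflictEssence.IsSymbolicConflictEssence E ρ₁ ρ₂ s →
      (∃ T : ConflictEssence.TransPair ρ₁.toPlainRule ρ₂.toPlainRule,
        T.IsValid ∧ s.EmbedsIn T) →
      ∃ K : ConflictEssence.TransPair ρ₁.toPlainRule ρ₂.toPlainRule,
        K.IsInitialConflict ∧
        (∀ T : ConflictEssence.TransPair ρ₁.toPlainRule ρ₂.toPlainRule,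
          T.IsValid → s.EmbedsIn T → K.EmbedsIn E T) ∧
        ∀ K' : ConflictEssence.TransPair ρ₁.toPlainRule ρ₂.toPlainRule,
          K'.IsInitialConflict →
          (∀ T : ConflictEssence.TransPair ρ₁.toPlainRule ρ₂.toPlainRule,
            T.IsValid → s.EmbedsIn T → ∃ f : K'.G ⟶ T.G, K'.IsExtension T f) →
          K'.IsIsomorphic K) ∧
    (∀ K T : ConflictEssence.TransPair ρ₁.toPlainRule ρ₂.toPlainRule,
      K.IsInitialConflict → T.IsValid → K.EmbedsIn E T →
      ∃ s : ConflictEssence.SymbolicOverlap ρ₁.L ρ₂.L,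
        ConflictEssence.IsSymbolicConflictEssence E ρ₁ ρ₂ s ∧ s.EmbedsIn T) := by
  refine ⟨fun s hs => ?_, fun K T _ hT ⟨f, hf, hsat⟩ => ?_⟩
  · rintro ⟨T, hT, hsT⟩
    obtain ⟨K, hK⟩ := hC.initialTransformations _ _ T
    obtain ⟨f, hf, -⟩ := id hK
    refine ⟨K, ⟨hK.of_isExtension hf, T, hT, hs.not_parallelIndependent hC hsT, f, hf⟩, ?_, ?_⟩
    · intro T' hT' hsT'
      obtain ⟨f₁, f₂, he, -⟩ := id hsT
      obtain ⟨f₁', f₂', he', -⟩ := id hsT'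
      obtain ⟨S, x, x', hx, hx'⟩ := ConflictEssence.Overlap.exists_common_restriction hC he he'
      obtain ⟨y, hy, -⟩ := hK.of_isExtension hx
      exact ⟨y ≫ x', hy.trans hx', (ConflictEssence.TransPair.sat_conditions_iff hC.adhesive
        hC.factorization (hy.trans hx')).2 ⟨hT', hs.not_parallelIndependent hC hsT'⟩⟩
    · intro K' hK' hext
      obtain ⟨f', hf'⟩ := hext T hT hsT
      exact hK'.1.isIsomorphic (hK.of_isExtension hf')
  · exact ConflictEssence.exists_symbolicConflictEssence hC hT
      ((ConflictEssence.TransPair.sat_conditions_iff hC.adhesive hC.factorization hf).1 hsat).2
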